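/- Let $(M,\omega)$ be a connected symplectic manifold of dimension $2n$ (smooth, Hausdorff, second countable, without boundary), $N=C^\infty(M,\mathbb{C})$, and $N_c\subset N$ the ideal of compactly supported functions. Let $*$ be a (differential) star product on $(M,\omega)$, that is, an associative $\mathbb{C}[[\nu]]$-bilinear product on $N[[\nu]]$ of the form $$\Big(\sum_{i}\nu^i u_i\Big)*\Big(\sum_{j}\nu^j v_j\Big)=\sum_{k\ge 0}\nu^k\sum_{r+i+j=k} C_r(u_i,v_j),$$ where each $C_r\colon N\times N\to N$ is a bidifferential operator, $C_0(u,v)=uv$, and $C_1(u,v)-C_1(v,u)=\kappa\{u,v\}$ for a nonzero constant $\kappa$ (whose value depends on the normalization conventions), $\{\cdot,\cdot\}$ being the Poisson bracket of $\omega$. A trace of $*$ is a $\mathbb{C}[[\nu]]$-linear map $\tau\colon N_c[[\nu]]\to\mathbb{C}[\nu^{-1},\nu]]$ (the formal Laurent series in $\nu$) such that $\tau(u*v)=\tau(v*u)$ for all $u,v\in N_c[[\nu]]$. Then any two traces of $*$ are proportional: if $\tau$ and $\tau'$ are traces of $*$ and $\tau\neq 0$, there is $c\in\mathbb{C}[\nu^{-1},\nu]]$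 such that $\tau'(u)=c\,\tau(u)$ for all $u\in N_c[[\nu]]$. -/

import Mathlib

open scoped Manifold ContDiff Topology

namespace StarTrace

/-- The model space `ℝ^d`. -/
abbrev E (d : ℕ) : Type := EuclideanSpace ℝ (Fin d)

/-- The standard basis vector `e_i` of `ℝ^d`. -/
noncomputable abbrev e {d : ℕ} (i : Fin d) : E d := EuclideanSpace.single i (1 : ℝ)

/-! ### Symplectic forms -/

section Symplectic

variable {d : ℕ} {M : Type*} [TopologicalSpace M] [ChartedSpace (E d) M]

/-- A (not necessarily continuous) field of alternating bilinear forms on the tangent spaces. -/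
abbrev TwoForm (d : ℕ) (M : Type*) [TopologicalSpace M] [ChartedSpace (E d) M] : Type _ :=
  ∀ x : M, (TangentSpace (𝓡 d) x) [⋀^Fin 2]→L[ℝ] ℝ

/-- The expression of a 2-form in the chart at `x₀`: the pullback by the inverse of the chart. -/
noncomputable def TwoForm.inChart (Ω : TwoForm d M) (x₀ : M) (y : E d) : (E d) [⋀^Fin 2]→L[ℝ] ℝ :=
  (Ω ((extChartAt (𝓡 d) x₀).symm y)).compContinuousLinearMap
    (mfderiv 𝓘(ℝ, E d) (𝓡 d) (extChartAt (𝓡 d) x₀).symm y)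

/-- Symplectic forms: smooth, closed, nondegenerate 2-forms. -/
structure IsSymplectic (Ω : TwoForm d M) : Prop where
  smooth : ∀ x₀ : M, ContDiffOn ℝ ∞ (Ω.inChart x₀) (extChartAt (𝓡 d) x₀).target
  closed : ∀ x₀ : M, ∀ y ∈ (extChartAt (𝓡 d) x₀).target, extDeriv (Ω.inChart x₀) y = 0
  nondegenerate : ∀ (x : M) (v : TangentSpace (𝓡 d) x),
    (∀ w : TangentSpace (𝓡 d) x, Ω x ![v, w] = 0) → v = 0

/-- The matrix `Ω_x(e_i, e_j)` of the form at `x` in the basis of `T_x M` given by the chart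
at `x`. -/
noncomputable def TwoForm.matrix (Ω : TwoForm d M) (x : M) : Matrix (Fin d) (Fin d) ℝ :=
  Matrix.of fun i j => Ω x ![(e i : E d), (e j : E d)]

/-- The derivative `du_x(e_i)` of a complex-valued function. -/
noncomputable def partialAt (u : M → ℂ) (x : M) (i : Fin d) : ℂ :=
  (mfderiv (𝓡 d) 𝓘(ℝ, ℂ) u x : E d →L[ℝ] ℂ) (e i)

/-- The Poisson bracket `{u, v} = ∑ Ω^{ij} ∂_i u ∂_j v`, where `(Ω^{ij})` is the inverse of the
matrix of `Ω`. Equivalently `{u, v} = dv(X_u)` with `Ω(X_u, ·) = du`. -/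
noncomputable def poisson (Ω : TwoForm d M) (u v : M → ℂ) (x : M) : ℂ :=
  ∑ i, ∑ j, (((Ω.matrix x)⁻¹ i j : ℝ) : ℂ) * partialAt u x i * partialAt v x j

end Symplectic

/-! ### Functions and formal power series of functions -/

/-- The algebra `N = C^∞(M, ℂ)`. -/
def Smooth (d : ℕ) (M : Type*) [TopologicalSpace M] [ChartedSpace (E d) M] :
    Subalgebra ℂ (M → ℂ) where
  carrier := {f | ContMDiff (𝓡 d) 𝓘(ℝ, ℂ) ∞ f}
  mul_mem' := fun hf hg => contDiff_mul.contMDiff.comp (hf.prodMk_space hg)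
  add_mem' := fun hf hg => hf.add hg
  algebraMap_mem' := fun _ => contMDiff_const

theorem hasCompactSupport_sum {d : ℕ} {M : Type*} [TopologicalSpace M] [ChartedSpace (E d) M]
    {ι : Type*} (s : Finset ι) (f : ι → Smooth d M)
    (hf : ∀ i ∈ s, HasCompactSupport (f i : M → ℂ)) :
    HasCompactSupport ((∑ i ∈ s, f i : Smooth d M) : M → ℂ) := by
  classical
  induction s using Finset.induction_on with
  | empty => simpa using (HasCompactSupport.zero : HasCompactSupport (0 : M → ℂ))
  | insert i s hi ih =>
    rw [Finset.sum_insert hi]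
    exact (hf i (Finset.mem_insert_self i s)).add
      (ih fun j hj => hf j (Finset.mem_insert_of_mem hj))

/-- `N_c[[ν]]`: the formal power series all of whose coefficients have compact support (the
supports need not lie in a common compact set), as a `ℂ[[ν]]`-submodule of `N[[ν]]`. -/
def CompactSeries (d : ℕ) (M : Type*) [TopologicalSpace M] [ChartedSpace (E d) M] :
    Submodule (PowerSeries ℂ) (PowerSeries (Smooth d M)) where
  carrier := {u | ∀ k, HasCompactSupport ((PowerSeries.coeff k u : Smooth d M) : M → ℂ)}
  add_mem' := by
    intro u v hu hv k
    have := (hu k).add (hv k)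
    simpa using this
  zero_mem' := by
    intro k
    simpa using (HasCompactSupport.zero : HasCompactSupport (0 : M → ℂ))
  smul_mem' := by
    intro a u hu k
    rw [Algebra.smul_def, PowerSeries.algebraMap_apply'', PowerSeries.coeff_mul]
    refine hasCompactSupport_sum _ _ fun p _ => ?_
    exact (hu p.2).mul_left

/-! ### Star products -/

section Star

variable {d : ℕ} {M : Type*} [TopologicalSpace M] [ChartedSpace (E d) M]

/-- The iterated partial derivative `∂_{J 0} ⋯ ∂_{J (k-1)} u` at `x`, in the chart at `x₀`. -/
noncomputable def chartDeriv (x₀ : M) {k : ℕ} (J : Fin k → Fin d) (u : M → ℂ) (x : M) : ℂ :=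
  iteratedFDeriv ℝ k (u ∘ (extChartAt (𝓡 d) x₀).symm) (extChartAt (𝓡 d) x₀ x) fun m => e (J m)

/-- Bidifferential operators: near every point, a finite sum
`∑ a_{J,K} ∂_J u ∂_K v` in the chart at that point, with smooth coefficients. -/
def IsBidifferential (B : Smooth d M →ₗ[ℂ] Smooth d M →ₗ[ℂ] Smooth d M) : Prop :=
  ∀ x₀ : M, ∃ U : Set M, IsOpen U ∧ x₀ ∈ U ∧ U ⊆ (chartAt (E d) x₀).source ∧
    ∃ (m : ℕ) (a : ∀ k l : ℕ, (Fin k → Fin d) → (Fin l → Fin d) → M → ℂ),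
      (∀ k l J K, ContMDiffOn (𝓡 d) 𝓘(ℝ, ℂ) ∞ (a k l J K) U) ∧
      ∀ (u v : Smooth d M), ∀ x ∈ U,
        (B u v : M → ℂ) x =
          ∑ k ∈ Finset.range (m + 1), ∑ l ∈ Finset.range (m + 1),
            ∑ J : Fin k → Fin d, ∑ K : Fin l → Fin d,
              a k l J K x * chartDeriv x₀ J u x * chartDeriv x₀ K v x

/-- The `ℂ[[ν]]`-bilinear extension to `N[[ν]]` of `u * v = ∑_r ν^r C_r(u, v)`: the coefficient of
`ν^k` in `u * v` is `∑_{r + i + j = k} C_r(u_i, v_j)`. -/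
noncomputable def starMul (C : ℕ → Smooth d M →ₗ[ℂ] Smooth d M →ₗ[ℂ] Smooth d M)
    (u v : PowerSeries (Smooth d M)) : PowerSeries (Smooth d M) :=
  PowerSeries.mk fun k => ∑ p ∈ Finset.HasAntidiagonal.antidiagonal k, ∑ q ∈ Finset.HasAntidiagonal.antidiagonal p.2,
    C p.1 (PowerSeries.coeff q.1 u) (PowerSeries.coeff q.2 v)

/-- Differential star products on `(M, Ω)`. The value of the nonzero constant `κ` depends on the
normalization conventions for `ν` and for the Poisson bracket, so it is left free. The function `1`
is not required to be a unit. -/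
structure StarProduct (Ω : TwoForm d M) where
  /-- The cochains `C_r`. -/
  C : ℕ → Smooth d M →ₗ[ℂ] Smooth d M →ₗ[ℂ] Smooth d M
  bidifferential : ∀ r, IsBidifferential (C r)
  assoc : ∀ u v w : PowerSeries (Smooth d M),
    starMul C (starMul C u v) w = starMul C u (starMul C v w)
  C_zero : ∀ u v, C 0 u v = u * v
  C_one : ∃ κ : ℂ, κ ≠ 0 ∧ ∀ (u v : Smooth d M) (x : M),
    (C 1 u v : M → ℂ) x - (C 1 v u : M → ℂ) x = κ * poisson Ω u v x

/-! ### `N_c[[ν]]` is closed under the star product -/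

theorem chartDeriv_eq_zero {x₀ : M} {k : ℕ} (J : Fin k → Fin d) {u : M → ℂ} {x : M}
    (hx : x ∈ (chartAt (E d) x₀).source) (hu : x ∉ tsupport u) : chartDeriv x₀ J u x = 0 := by
  have h1 : u =ᶠ[𝓝 x] 0 := notMem_tsupport_iff_eventuallyEq.mp hu
  have hc := continuousAt_extChartAt_symm' (I := 𝓡 d) (x := x₀) (x' := x)
    (by rwa [extChartAt_source])
  have hl : (extChartAt (𝓡 d) x₀).symm (extChartAt (𝓡 d) x₀ x) = x :=
    (extChartAt (𝓡 d) x₀).left_inv (by rwa [extChartAt_source])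
  have h2 : (u ∘ (extChartAt (𝓡 d) x₀).symm) =ᶠ[𝓝 (extChartAt (𝓡 d) x₀ x)] 0 := by
    unfold ContinuousAt at hc
    rw [hl] at hc
    exact hc.eventually h1
  unfold chartDeriv
  rw [(h2.iteratedFDeriv ℝ k).eq_of_nhds]
  simp

theorem IsBidifferential.hasCompactSupport
    {B : Smooth d M →ₗ[ℂ] Smooth d M →ₗ[ℂ] Smooth d M} (hB : IsBidifferential B)
    {u v : Smooth d M} (hu : HasCompactSupport (u : M → ℂ)) :
    HasCompactSupport (B u v : M → ℂ) := by
  refine hu.mono' ?_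
  intro x hx
  by_contra hxu
  refine hx ?_
  obtain ⟨U, -, hxU, hU, m, a, -, h⟩ := hB x
  rw [h u v x hxU]
  refine Finset.sum_eq_zero fun k _ => Finset.sum_eq_zero fun l _ =>
    Finset.sum_eq_zero fun J _ => Finset.sum_eq_zero fun K _ => ?_
  rw [chartDeriv_eq_zero J (hU hxU) hxu]
  simp

theorem StarProduct.starMul_mem {Ω : TwoForm d M} (S : StarProduct Ω)
    (u v : CompactSeries d M) : starMul S.C (u : PowerSeries (Smooth d M)) v ∈ CompactSeries d M := by
  intro k
  simp only [starMul, PowerSeries.coeff_mk]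
  exact hasCompactSupport_sum _ _ fun p _ => hasCompactSupport_sum _ _ fun q _ =>
    (S.bidifferential p.1).hasCompactSupport (u.2 q.1)

/-- The star product `u * v` of elements of `N_c[[ν]]`. -/
noncomputable def StarProduct.mul {Ω : TwoForm d M} (S : StarProduct Ω)
    (u v : CompactSeries d M) : CompactSeries d M :=
  ⟨starMul S.C u v, S.starMul_mem u v⟩

/-- Traces: `ℂ[[ν]]`-linear maps `τ : N_c[[ν]] → ℂ[ν⁻¹, ν]]` with `τ(u * v) = τ(v * u)`. -/
def IsTrace {Ω : TwoForm d M} (S : StarProduct Ω)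
    (τ : CompactSeries d M →ₗ[PowerSeries ℂ] LaurentSeries ℂ) : Prop :=
  ∀ u v : CompactSeries d M, τ (S.mul u v) = τ (S.mul v u)

end Star

end StarTrace

/-!
A trace `τ` is determined by its value on a single element. Modulo star commutators, `N_c[[ν]]` is
generated over `ℂ[[ν]]` by one function `ρ`: for every `u` there is `c ∈ ℂ[[ν]]` such that
`ν (u - c ρ)` is a finite sum of star commutators (`exists_eq_smul_add_commutator`). As `ν` is
invertible in the Laurent series, `τ u = c τ(ρ)` with `c` independent of `τ` (`IsTrace.eq_smul`), and
proportionality follows.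

*Leading order.* The antisymmetrization of `C_0` vanishes and that of `C_1` is `κ {·,·}`, so the
lowest term of a commutator is a Poisson bracket. The classical input is that on a connected
symplectic manifold compactly supported functions form a line modulo Poisson brackets. It is used
in the form `f = c ρ + ∑_j {a_j, b_j}`, with a *finite* family `b_j` that does not depend on `f`
and functions `a_j` with compact support (`SpansCotangent.exists_global`). Any finite family works
whose differentials span all cotangent spaces. In a cube in a chart, let `D` be the Liouville
density. If `∫ D f = 0`, then `D f` is the divergence of a vector field supported in the cube, by
the Poincaré lemma with compact supports (`exists_divergence_eq`). This vector field is a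
combination of the Hamiltonian vector fields of the `b_j`, which span the tangent spaces. By
Liouville's theorem `D {a, b_j}` is the divergence of `a D X_j`, with `X_j` the Hamiltonian vector
field of `b_j`, so the coefficients of the combination serve as the `a_j`
(`IsSymplecticMatrix.exists_bracket_eq`). Connectedness and a partition of unity globalize this.

*The family `b_j`.* On a compact set finitely many functions have spanning differentials, and
Whitney's projection argument reduces their number to `2d`, `d` being the dimension of `M`: the
differential of a map to `ℝ^N` takes values in a set of Hausdorff dimension at most `2d`, hence
misses a direction if `N > 2d`. Cut `M` into annuli of an exhaustion and colour them cyclically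
with four colours, so that neighbourhoods of annuli of one colour are disjoint; then the functions
for the annuli of one colour can be added up, and `4 · 2d` functions suffice for all of `M`
(`exists_spansCotangent`).

*Recursion.* The coefficient of `ν^{n+1}` in `∑_j [a_j, b_j]` is `κ ∑_j {a_{j,n}, b_j}` plus terms
in the coefficients `a_{j,p}` with `p < n`, so `c` and the `a_j` are found order by order. The
family `b_j` being fixed and finite, the result is a finite sum of commutators.

*Noncompact supports.* The `b_j` do not have compact support, so that `τ [a, b_j] = 0` has to be
proved (`IsTrace.commutator_eq_zero`). If the supports of all the coefficients of `a` lie in one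
compact set, `b_j` can be cut off. In general they do not, but each order of `a` vanishes on all
but finitely many annuli. Hence `a = ∑_k χ_k a` with `χ_k a` divisible by `ν^{2 t_k}` and `t_k →
∞`. Replacing `χ_k a` by `ν^{-t_k} χ_k a` and `b` by `ν^{t_k} θ_k b`, with `θ_k` a cutoff near
annulus `k`, does not change the product. Both factors keep the order `t_k`, so that each
coefficient of their sums over the annuli of one colour involves finitely many annuli, and these
sums are elements of `N_c[[ν]]`.
-/

namespace StarTrace

/-! ### The Poincaré lemma with compact supports on a cube -/

section Poincare

open MeasureTheory Set

variable {d : ℕ}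

/-- The open cube of half-side `r` about `y`. -/
def cube (y : E d) (r : ℝ) : Set (E d) := {x | ∀ i, |x i - y i| < r}

theorem isOpen_cube (y : E d) (r : ℝ) : IsOpen (cube y r) := by
  have : cube y r = ⋂ i, {x : E d | |x i - y i| < r} := by ext; simp [cube]
  rw [this]
  exact isOpen_iInter_of_finite fun i => isOpen_lt (by fun_prop) continuous_const

theorem mem_cube_self (y : E d) {r : ℝ} (hr : 0 < r) : y ∈ cube y r := by
  intro i; simpa using hr

theorem exists_cube_subset {y : E d} {U : Set (E d)} (hU : U ∈ 𝓝 y) :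
    ∃ r > 0, cube y r ⊆ U := by
  have hU' : (WithLp.toLp 2 : (Fin d → ℝ) → E d) ⁻¹' U ∈ 𝓝 (WithLp.ofLp y) :=
    (PiLp.continuous_toLp 2 _).continuousAt.preimage_mem_nhds (by simpa using hU)
  obtain ⟨r, hr, h⟩ := Metric.mem_nhds_iff.mp hU'
  refine ⟨r, hr, fun x hx => ?_⟩
  have : WithLp.ofLp x ∈ Metric.ball (WithLp.ofLp y) r := by
    rw [Metric.mem_ball, dist_pi_lt_iff hr]
    intro i; rw [Real.dist_eq]; exact hx i
  exact h this

theorem exists_coord_ge_of_notMem_cube {y x : E d} {r : ℝ} (h : x ∉ cube y r) :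
    ∃ i, r ≤ |x i - y i| := by
  simpa [cube] using h

theorem isCompact_closedCube (y : E d) (r : ℝ) : IsCompact {x : E d | ∀ i, |x i - y i| ≤ r} := by
  have : {x : E d | ∀ i, |x i - y i| ≤ r}
      = (WithLp.toLp 2 : (Fin d → ℝ) → E d) '' (Set.univ.pi fun i => Set.Icc (y i - r) (y i + r)) := by
    ext x
    constructor
    · intro hx
      refine ⟨WithLp.ofLp x, fun i _ => ?_, by simp⟩
      have := abs_le.mp (hx i)
      constructor <;> linarith [this.1, this.2]
    · rintro ⟨z, hz, rfl⟩ i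
      have := hz i (mem_univ i)
      rw [abs_le]
      constructor <;> simp <;> linarith [this.1, this.2]
  rw [this]
  exact (isCompact_univ_pi fun i => isCompact_Icc).image (PiLp.continuous_toLp 2 _)

theorem hasCompactSupport_of_cube {F : Type*} [Zero F] {f : E d → F} {y : E d} {r : ℝ}
    (h : ∀ x ∉ cube y r, f x = 0) : HasCompactSupport f :=
  HasCompactSupport.intro (isCompact_closedCube y r) fun x hx => h x fun hx' => hx fun i => (hx' i).le

theorem coord_add_smul_e (x : E d) (t : ℝ) (i j : Fin d) :
    (x + t • (e i : E d)) j = x j + if j = i then t else 0 := by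
  simp [e]

theorem eq_sum_smul_e (v : E d) : v = ∑ k, v k • (e k : E d) := by
  ext i
  simp [e, Pi.single_apply]

/-- Weighted integrals along the `i`-th coordinate direction of a smooth function which vanishes
outside a slab depend smoothly on the base point. -/
theorem contDiff_lineIntegral {K : E d → ℂ} (hK : ContDiff ℝ ∞ K) (i : Fin d) {c r : ℝ}
    (h0 : ∀ x, r ≤ |x i - c| → K x = 0) {f : ℝ → ℝ} (hf : LocallyIntegrable f) :
    ContDiff ℝ ∞ fun x => ∫ t, f t • K (x + (0 - t) • (e i : E d)) := by
  rw [contDiff_iff_contDiffAt]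
  intro x₀
  have := contDiffOn_convolution_right_with_param_comp (𝕜 := ℝ) (n := ⊤) (μ := (volume : Measure ℝ))
    (ContinuousLinearMap.lsmul ℝ ℝ : ℝ →L[ℝ] ℂ →L[ℝ] ℂ)
    (s := {x : E d | |x i - x₀ i| < 1}) (v := fun _ => (0 : ℝ)) contDiffOn_const (f := f)
    (g := fun x s => K (x + s • (e i : E d))) (k := Icc (c - x₀ i - 1 - r) (c - x₀ i + 1 + r))
    (isOpen_lt (by fun_prop) continuous_const) isCompact_Icc ?_ hf ?_
  · exact this.contDiffAt ((isOpen_lt (by fun_prop) continuous_const).mem_nhds (by simp))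
  · intro p s hp hs
    apply h0
    rw [coord_add_smul_e, if_pos rfl]
    by_contra hlt
    push Not at hlt
    apply hs
    have h1 := abs_lt.mp hlt
    have h2 := abs_lt.mp (show |p i - x₀ i| < 1 from hp)
    constructor <;> linarith [h1.1, h1.2, h2.1, h2.2]
  · apply ContDiff.contDiffOn
    change ContDiff ℝ ∞ fun q : E d × ℝ => K (q.1 + q.2 • (e i : E d))
    fun_prop

theorem hasCompactSupport_line {K : E d → ℂ} {i : Fin d} {c r : ℝ}
    (h0 : ∀ x, r ≤ |x i - c| → K x = 0) (x : E d) :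
    HasCompactSupport fun t : ℝ => K (x + t • (e i : E d)) := by
  refine HasCompactSupport.intro (K := Icc (c - x i - r) (c - x i + r)) isCompact_Icc ?_
  intro t ht
  apply h0
  rw [coord_add_smul_e, if_pos rfl]
  by_contra hlt
  push Not at hlt
  apply ht
  have h1 := abs_lt.mp hlt
  constructor <;> linarith [h1.1, h1.2]

/-- A function `N` whose integrals along all lines in direction `e_i` vanish is the `i`-th partial
derivative of a function `G`, which vanishes on every such line on which `N` vanishes. -/
theorem exists_primitive {N : E d → ℂ} (hN : ContDiff ℝ ∞ N) (i : Fin d) {c r : ℝ}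
    (h0 : ∀ x, r ≤ |x i - c| → N x = 0) (hint : ∀ x, ∫ t : ℝ, N (x + t • (e i : E d)) = 0) :
    ∃ G : E d → ℂ, ContDiff ℝ ∞ G ∧ (∀ x, fderiv ℝ G x (e i) = N x) ∧
      (∀ x, r ≤ |x i - c| → G x = 0) ∧
      ∀ x, (∀ t : ℝ, N (x + t • (e i : E d)) = 0) → G x = 0 := by
  -- `G` is the convolution of `N` with the Heaviside function along the `i`-th direction
  have hf : LocallyIntegrable (indicator (Ici (0 : ℝ)) fun _ => (1 : ℝ)) :=
    (locallyIntegrable_const 1).indicator measurableSet_Ici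
  have hcont : ∀ x : E d, Continuous fun t : ℝ => N (x + t • (e i : E d)) := fun x => by
    have := hN.continuous
    fun_prop
  have hI : ∀ x : E d, Integrable fun t : ℝ => N (x + t • (e i : E d)) := fun x =>
    (hcont x).integrable_of_hasCompactSupport (hasCompactSupport_line h0 x)
  set G : E d → ℂ := fun x =>
    ∫ t, (indicator (Ici (0 : ℝ)) fun _ => (1 : ℝ)) t • N (x + (0 - t) • (e i : E d)) with hG
  have hG1 : ∀ x, G x = ∫ t in Iic (0 : ℝ), N (x + t • (e i : E d)) := by
    intro x
    rw [hG]
    simp only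
    rw [← integral_neg_eq_self, ← integral_indicator measurableSet_Iic]
    congr 1
    ext t
    by_cases ht : t ≤ 0
    · simp [indicator, ht]
    · simp [indicator, ht]
  have hG2 : ∀ x (s : ℝ), G (x + s • (e i : E d)) = ∫ t in Iic s, N (x + t • (e i : E d)) := by
    intro x s
    rw [hG1, ← integral_indicator measurableSet_Iic, ← integral_indicator measurableSet_Iic,
      ← integral_add_right_eq_self ((Iic s).indicator _) s]
    congr 1
    ext t
    simp only [indicator, mem_Iic, add_le_iff_nonpos_left]
    rw [add_assoc, ← add_smul, add_comm s t]
  have hGs : ContDiff ℝ ∞ G := contDiff_lineIntegral hN i h0 hf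
  refine ⟨G, hGs, fun x => ?_, fun x hx => ?_, fun x hx => ?_⟩
  · have h1 : HasDerivAt (fun s : ℝ => G (x + s • (e i : E d))) (fderiv ℝ G x (e i)) 0 := by
      have := ((hGs.differentiable (by simp)) x).hasFDerivAt.hasLineDerivAt (e i)
      exact this
    have h2 : HasDerivAt (fun s : ℝ => G (x + s • (e i : E d))) (N x) 0 := by
      have h3 : (fun s : ℝ => G (x + s • (e i : E d)))
          = fun s => G x + ∫ t in (0 : ℝ)..s, N (x + t • (e i : E d)) := by
        ext s
        rw [hG2, hG1, ← intervalIntegral.integral_Iic_sub_Iic (hI x).integrableOn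
          (hI x).integrableOn]
        ring
      rw [h3]
      have := intervalIntegral.integral_hasDerivAt_right
        ((hcont x).intervalIntegrable 0 0) ((hcont x).stronglyMeasurableAtFilter _ _)
        (hcont x).continuousAt
      simpa using this.const_add (G x)
    exact h1.unique h2
  · rcases le_abs.mp hx with h | h
    · rw [hG1]
      have : ∫ t in Ioi (0 : ℝ), N (x + t • (e i : E d)) = 0 := by
        refine setIntegral_eq_zero_of_forall_eq_zero fun t ht => h0 _ ?_
        rw [coord_add_smul_e, if_pos rfl]
        refine le_trans ?_ (le_abs_self _)
        have : 0 < t := ht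
        linarith
      have h2 := integral_add_compl (measurableSet_Iic (a := (0 : ℝ))) (hI x)
      rw [compl_Iic, this, hint, add_zero] at h2
      exact h2
    · rw [hG1]
      refine setIntegral_eq_zero_of_forall_eq_zero fun t ht => h0 _ ?_
      rw [coord_add_smul_e, if_pos rfl]
      refine le_trans ?_ (neg_le_abs _)
      have : t ≤ 0 := ht
      linarith
  · rw [hG1]
    exact setIntegral_eq_zero_of_forall_eq_zero fun t _ => hx t

/-- The induction for the Poincaré lemma with compact supports in top degree: up to a divergence,
`F` is the product of bumps `φ` of integral `1` in the coordinates in `s` and of the integral `K` of `F`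
over these coordinates. Smoothness is stated for the product, which is what the construction of
primitives uses. -/
theorem exists_divergence_add_product {y : E d} {r : ℝ} {φ : ℝ → ℝ} (hφ : ContDiff ℝ ∞ φ)
    (hφ0 : ∀ t, r ≤ |t| → φ t = 0) (hφ1 : ∫ t, φ t = 1) {F : E d → ℂ} (hF : ContDiff ℝ ∞ F)
    (hF0 : ∀ x ∉ cube y r, F x = 0) (s : Finset (Fin d)) :
    ∃ (G : Fin d → E d → ℂ) (K : E d → ℂ), (∀ i, ContDiff ℝ ∞ (G i)) ∧
      (∀ i, ∀ x ∉ cube y r, G i x = 0) ∧ (∀ x x', (∀ j ∉ s, x j = x' j) → K x = K x') ∧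
      ContDiff ℝ ∞ (fun x => ((∏ j ∈ s, φ (x j - y j) : ℝ) : ℂ) * K x) ∧
      (∀ x, (∃ j ∉ s, r ≤ |x j - y j|) → K x = 0) ∧
      ∀ x, F x = ((∏ j ∈ s, φ (x j - y j) : ℝ) : ℂ) * K x + ∑ i, fderiv ℝ (G i) x (e i) := by
  classical
  induction s using Finset.induction_on with
  | empty =>
    refine ⟨fun _ _ => 0, F, fun _ => contDiff_const, fun _ _ _ => rfl, fun x x' h => ?_, ?_, ?_, ?_⟩
    · congr 1
      ext j; exact h j (by simp)
    · simpa using hF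
    · rintro x ⟨j, -, hj⟩
      exact hF0 x fun hx => absurd (hx j) (not_lt.mpr hj)
    · simp
  | insert i s hi ih =>
    obtain ⟨G, K, hG, hG0, hK, hKs, hK0, hFe⟩ := ih
    set P : E d → ℂ := fun x => ((∏ j ∈ s, φ (x j - y j) : ℝ) : ℂ) * K x with hP
    set K' : E d → ℂ := fun x => ∫ t : ℝ, K (x + t • (e i : E d)) with hK'
    have hprod : ∀ (x : E d) (t : ℝ), (∏ j ∈ s, φ ((x + t • (e i : E d)) j - y j))
        = ∏ j ∈ s, φ (x j - y j) := by
      intro x t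
      refine Finset.prod_congr rfl fun j hj => ?_
      rw [coord_add_smul_e, if_neg (by rintro rfl; exact hi hj), add_zero]
    have hPcube : ∀ x ∉ cube y r, P x = 0 := by
      intro x hx
      obtain ⟨j, hj⟩ := exists_coord_ge_of_notMem_cube hx
      by_cases hjs : j ∈ s
      · simp only [hP]
        rw [Finset.prod_eq_zero hjs (hφ0 _ hj)]
        simp
      · simp only [hP]
        rw [hK0 x ⟨j, hjs, hj⟩, mul_zero]
    have hPi : ∀ x : E d, r ≤ |x i - y i| → P x = 0 := fun x hx => by
      simp only [hP]; rw [hK0 x ⟨i, hi, hx⟩, mul_zero]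
    -- the integral of `P` along the `i`-th direction
    have hPK : ∀ x, ∫ t : ℝ, P (x + t • (e i : E d))
        = ((∏ j ∈ s, φ (x j - y j) : ℝ) : ℂ) * K' x := by
      intro x
      simp only [hP, hprod, hK']
      rw [integral_const_mul]
    have hK'i : ∀ (x : E d) (t : ℝ), K' (x + t • (e i : E d)) = K' x := by
      intro x t
      simp only [hK']
      rw [← integral_add_right_eq_self (fun u : ℝ => K (x + u • (e i : E d))) t]
      congr 1; ext u
      rw [add_smul, ← add_assoc, add_right_comm]
    have hPKs : ContDiff ℝ ∞ fun x => ((∏ j ∈ s, φ (x j - y j) : ℝ) : ℂ) * K' x := by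
      have := contDiff_lineIntegral hKs i hPi (f := fun _ => 1) (locallyIntegrable_const 1)
      convert this using 2 with x
      rw [← hPK, ← integral_neg_eq_self]
      simp [hP]
    have hPK's : ContDiff ℝ ∞ fun x => ((∏ j ∈ insert i s, φ (x j - y j) : ℝ) : ℂ) * K' x := by
      simp only [Finset.prod_insert hi, Complex.ofReal_mul, mul_assoc]
      have h1 : ContDiff ℝ ∞ fun x : E d => ((φ (x i - y i) : ℝ) : ℂ) :=
        Complex.ofRealCLM.contDiff.comp (hφ.comp (by fun_prop))
      exact h1.mul hPKs
    -- the difference has integral zero along the `i`-th direction, hence is a partial derivative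
    set N : E d → ℂ := fun x => P x - ((∏ j ∈ insert i s, φ (x j - y j) : ℝ) : ℂ) * K' x with hN
    have hNs : ContDiff ℝ ∞ N := hKs.sub hPK's
    have hK'0 : ∀ x, (∃ j ∉ insert i s, r ≤ |x j - y j|) → K' x = 0 := by
      rintro x ⟨j, hj, hjr⟩
      simp only [hK']
      refine integral_eq_zero_of_ae (Filter.Eventually.of_forall fun t => hK0 _ ⟨j, ?_, ?_⟩)
      · exact fun h => hj (Finset.mem_insert_of_mem h)
      · rw [coord_add_smul_e, if_neg (by rintro rfl; exact hj (Finset.mem_insert_self _ _)), add_zero]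
        exact hjr
    have hNcube : ∀ x ∉ cube y r, N x = 0 := by
      intro x hx
      simp only [hN]
      rw [hPcube x hx, zero_sub, neg_eq_zero]
      obtain ⟨j, hj⟩ := exists_coord_ge_of_notMem_cube hx
      by_cases hjs : j ∈ insert i s
      · rw [Finset.prod_eq_zero hjs (hφ0 _ hj)]
        simp
      · rw [hK'0 x ⟨j, hjs, hj⟩, mul_zero]
    have hNi : ∀ x : E d, r ≤ |x i - y i| → N x = 0 := fun x hx =>
      hNcube x fun h => absurd (h i) (not_lt.mpr hx)
    have hprod' : ∀ (x : E d) (t : ℝ), (∏ j ∈ insert i s, φ ((x + t • (e i : E d)) j - y j))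
        = φ (x i - y i + t) * ∏ j ∈ s, φ (x j - y j) := by
      intro x t
      rw [Finset.prod_insert hi, hprod, coord_add_smul_e, if_pos rfl]
      congr 2; ring
    have hφc : HasCompactSupport φ :=
      HasCompactSupport.intro (K := Icc (-r) r) isCompact_Icc fun t ht => hφ0 t (by
        by_contra h
        push Not at h
        exact ht ⟨(abs_lt.mp h).1.le, (abs_lt.mp h).2.le⟩)
    have hNint : ∀ x, ∫ t : ℝ, N (x + t • (e i : E d)) = 0 := by
      intro x
      simp only [hN, hK'i, hprod']
      rw [integral_sub, hPK, integral_mul_const]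
      · have : ∫ t : ℝ, ((φ (x i - y i + t) * ∏ j ∈ s, φ (x j - y j) : ℝ) : ℂ)
            = ((∏ j ∈ s, φ (x j - y j) : ℝ) : ℂ) := by
          rw [integral_complex_ofReal, integral_mul_const, integral_add_left_eq_self, hφ1, one_mul]
        rw [this, sub_self]
      · have hc := hKs.continuous
        refine Continuous.integrable_of_hasCompactSupport ?_ (hasCompactSupport_line hPi x)
        fun_prop
      · refine Integrable.mul_const ?_ _
        refine Integrable.ofReal (Integrable.mul_const ?_ _)
        exact (hφ.continuous.integrable_of_hasCompactSupport hφc).comp_add_left _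
    obtain ⟨g, hg, hgN, hgi, hg0⟩ := exists_primitive hNs i hNi hNint
    have hgcube : ∀ x ∉ cube y r, g x = 0 := by
      intro x hx
      obtain ⟨j, hj⟩ := exists_coord_ge_of_notMem_cube hx
      by_cases hji : j = i
      · subst hji; exact hgi x hj
      · refine hg0 x fun t => hNcube _ fun h => ?_
        have := h j
        rw [coord_add_smul_e, if_neg hji, add_zero] at this
        exact absurd this (not_lt.mpr hj)
    refine ⟨fun j => G j + if j = i then g else 0, K', fun j => ?_, fun j x hx => ?_, ?_, hPK's,
      hK'0, fun x => ?_⟩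
    · refine (hG j).add ?_
      split_ifs
      · exact hg
      · exact contDiff_const
    · change G j x + (if j = i then g else 0) x = 0
      rw [hG0 j x hx]
      split_ifs
      · rw [hgcube x hx, add_zero]
      · simp
    · intro x x' h
      have hx : ∀ t : ℝ, K (x' + (x i - x' i) • (e i : E d) + t • (e i : E d))
          = K (x + t • (e i : E d)) := by
        intro t
        refine hK _ _ fun j hj => ?_
        rw [coord_add_smul_e, coord_add_smul_e, coord_add_smul_e]
        by_cases hji : j = i
        · subst hji; simp
        · simp [hji, h j (by simp [hji, hj])]
      rw [← hK'i x' (x i - x' i)]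
      simp only [hK', hx]
    · rw [hFe x]
      have hsum : ∑ j, fderiv ℝ (G j + if j = i then g else 0) x (e j)
          = ∑ j, fderiv ℝ (G j) x (e j) + N x := by
        have h1 : N x = ∑ j, if j = i then fderiv ℝ g x (e j) else 0 := by
          rw [Finset.sum_ite_eq', if_pos (Finset.mem_univ i), hgN x]
        rw [h1, ← Finset.sum_add_distrib]
        refine Finset.sum_congr rfl fun j _ => ?_
        by_cases hj : j = i
        · simp only [hj, if_true]
          rw [fderiv_add ((hG i).differentiable (by simp) x) (hg.differentiable (by simp) x)]
          rfl
        · simp [hj]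
      rw [hsum]
      simp only [hN, hP]
      ring

theorem integral_fderiv_apply_eq_zero {G : E d → ℂ} (hG : ContDiff ℝ ∞ G)
    (hc : HasCompactSupport G) (v : E d) : ∫ x, fderiv ℝ G x v = 0 := by
  have h := integral_mul_fderiv_eq_neg_fderiv_mul_of_integrable (μ := (volume : Measure (E d)))
    (𝕜 := ℂ) (f := fun _ : E d => (1 : ℂ)) (g := G) (v := v) (by simp) ?_ ?_ (by simp) ?_
  · simpa using h
  · simp only [one_mul]
    refine Continuous.integrable_of_hasCompactSupport ?_ (hc.fderiv_apply (𝕜 := ℝ) v)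
    exact (hG.continuous_fderiv (by simp)).clm_apply continuous_const
  · simp only [one_mul]
    exact hG.continuous.integrable_of_hasCompactSupport hc
  · exact fun x _ => hG.differentiable (by simp) x

/-- The **Poincaré lemma with compact supports** in top degree: a function supported in a cube, of
integral zero, is the divergence of a vector field supported in the cube. -/
theorem exists_divergence_eq {y : E d} {r : ℝ} (hr : 0 < r) {F : E d → ℂ} (hF : ContDiff ℝ ∞ F)
    (hF0 : ∀ x ∉ cube y r, F x = 0) (hint : ∫ x, F x = 0) :
    ∃ G : Fin d → E d → ℂ, (∀ i, ContDiff ℝ ∞ (G i)) ∧ (∀ i, ∀ x ∉ cube y r, G i x = 0) ∧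
      ∀ x, F x = ∑ i, fderiv ℝ (G i) x (e i) := by
  let b : ContDiffBump (0 : ℝ) := ⟨r / 2, r, by positivity, by linarith⟩
  let φ : ℝ → ℝ := b.normed volume
  have hφ : ContDiff ℝ ∞ φ := b.contDiff_normed
  have hφ0 : ∀ t, r ≤ |t| → φ t = 0 := by
    intro t ht
    have : t ∉ Function.support φ := by
      rw [b.support_normed_eq]
      simpa [b] using ht
    exact Function.notMem_support.mp this
  have hφ1 : ∫ t, φ t = 1 := b.integral_normed
  obtain ⟨G, K, hG, hG0, hK, hKs, hK0, hFe⟩ :=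
    exists_divergence_add_product hφ hφ0 hφ1 hF hF0 Finset.univ
  refine ⟨G, hG, hG0, ?_⟩
  have hKc : ∀ x, K x = K y := fun x => hK x y (by simp)
  have hGc : ∀ i, HasCompactSupport (G i) := fun i => hasCompactSupport_of_cube (hG0 i)
  have hi : ∀ i, Integrable fun x => fderiv ℝ (G i) x (e i) := fun i =>
    Continuous.integrable_of_hasCompactSupport
      (((hG i).continuous_fderiv (by simp)).clm_apply continuous_const)
      ((hGc i).fderiv_apply (𝕜 := ℝ) _)
  have hφint : Integrable fun x : E d => ∏ j, φ (x j - y j) := by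
    refine Continuous.integrable_of_hasCompactSupport ?_ (hasCompactSupport_of_cube (y := y) (r := r) ?_)
    · have := hφ.continuous
      fun_prop
    · intro x hx
      obtain ⟨j, hj⟩ := exists_coord_ge_of_notMem_cube hx
      exact Finset.prod_eq_zero (Finset.mem_univ j) (hφ0 _ hj)
  have hρ : ∫ x : E d, ∏ j, φ (x j - y j) = 1 := by
    have h1 := (EuclideanSpace.volume_preserving_symm_measurableEquiv_toLp (Fin d)).integral_comp'
      (fun z : Fin d → ℝ => ∏ j, φ (z j - y j))
    have h2 : ∫ z : Fin d → ℝ, ∏ j, φ (z j - y j) = ∏ j, ∫ t, φ (t - y j) :=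
      integral_fintype_prod_volume_eq_prod (fun j t => φ (t - y j))
    rw [h2] at h1
    simp only [integral_sub_right_eq_self, hφ1, Finset.prod_const_one] at h1
    exact h1
  -- once all coordinates are integrated out, `K` is the constant `∫ F`
  have hzero : K y = 0 := by
    have h1 : ∫ x, F x = (∫ x : E d, ((∏ j, φ (x j - y j) : ℝ) : ℂ)) * K y := by
      rw [integral_congr_ae (Filter.Eventually.of_forall hFe)]
      simp only [hKc]
      rw [integral_add (f := fun x : E d => ((∏ j, φ (x j - y j) : ℝ) : ℂ) * K y)
          (g := fun x => ∑ i, fderiv ℝ (G i) x (e i))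
          (hφint.ofReal.mul_const _) (integrable_finsetSum _ fun i _ => hi i),
        integral_finsetSum _ fun i _ => hi i]
      simp only [integral_fderiv_apply_eq_zero (hG _) (hGc _), Finset.sum_const_zero, add_zero]
      rw [integral_mul_const]
    rw [hint, integral_complex_ofReal, hρ] at h1
    simpa using h1.symm
  intro x
  rw [hFe x, hKc x, hzero]
  simp

end Poincare

/-! ### The Liouville density and Hamiltonian vector fields -/

section Liouville

open Matrix

variable {d : ℕ}

/-- **Jacobi's formula**: `(det A)' = tr (adj(A) A')`. -/
theorem hasDerivAt_det {ι : Type*} [Fintype ι] [DecidableEq ι] {A : ℝ → Matrix ι ι ℝ}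
    {A' : Matrix ι ι ℝ} {t : ℝ} (h : ∀ a b, HasDerivAt (fun s => A s a b) (A' a b) t) :
    HasDerivAt (fun s => (A s).det) (∑ i, ∑ k, (A t).adjugate i k * A' k i) t := by
  have h1 : ∀ i, ∑ k, (A t).adjugate i k * A' k i
      = ((A t).updateCol i fun k => A' k i).det := by
    intro i
    rw [← cramer_apply, cramer_eq_adjugate_mulVec]
    rfl
  have h2 : ∑ i, ((A t).updateCol i fun k => A' k i).det = ∑ σ : Equiv.Perm ι,
      ∑ i, Equiv.Perm.sign σ • ∏ j, ((A t).updateCol i fun k => A' k i) (σ j) j := by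
    simp only [det_apply]
    rw [Finset.sum_comm]
  simp only [h1, h2]
  simp only [det_apply]
  refine HasDerivAt.fun_sum (u := Finset.univ) (A := fun σ s =>
    Equiv.Perm.sign σ • ∏ j, A s (σ j) j) fun σ _ => ?_
  refine ((HasDerivAt.fun_finsetProd (u := Finset.univ) (f := fun i s => A s (σ i) i)
    (fun i _ => h (σ i) i)).const_smul (Equiv.Perm.sign σ : ℤ)).congr_deriv ?_
  rw [Finset.smul_sum]
  refine Finset.sum_congr rfl fun i _ => ?_
  rw [← Finset.mul_prod_erase Finset.univ _ (Finset.mem_univ i), smul_eq_mul, mul_comm,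
    Units.smul_def]
  congr 2
  · rw [updateCol_self]
  · refine Finset.prod_congr rfl fun j hj => ?_
    rw [updateCol_ne (Finset.ne_of_mem_erase hj)]

theorem contDiffOn_det {ι V : Type*} [Fintype ι] [DecidableEq ι] [NormedAddCommGroup V]
    [NormedSpace ℝ V] {T : Set V} {A : V → Matrix ι ι ℝ}
    (h : ∀ a b, ContDiffOn ℝ ∞ (fun y => A y a b) T) :
    ContDiffOn ℝ ∞ (fun y => (A y).det) T := by
  simp only [det_apply]
  refine ContDiffOn.sum fun σ _ => ContDiffOn.const_smul _ ?_
  exact contDiffOn_prod fun i _ => h _ _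

theorem contDiffOn_inv {ι V : Type*} [Fintype ι] [DecidableEq ι] [NormedAddCommGroup V]
    [NormedSpace ℝ V] {T : Set V} {A : V → Matrix ι ι ℝ}
    (h : ∀ a b, ContDiffOn ℝ ∞ (fun y => A y a b) T) (hdet : ∀ y ∈ T, (A y).det ≠ 0) (a b : ι) :
    ContDiffOn ℝ ∞ (fun y => (A y)⁻¹ a b) T := by
  have h1 : ∀ y, (A y)⁻¹ a b = (A y).det⁻¹ * (A y).adjugate a b := by
    intro y
    rw [inv_def, Matrix.smul_apply, Ring.inverse_eq_inv', smul_eq_mul]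
  simp only [h1]
  refine ((contDiffOn_det h).inv hdet).mul ?_
  simp only [adjugate_apply]
  refine contDiffOn_det fun i j => ?_
  by_cases hi : i = b
  · subst hi
    simp only [updateRow_self]
    exact contDiffOn_const
  · simp only [updateRow_ne hi]
    exact h i j

/-- The properties, on an open set `T` of `ℝ^d`, of the matrix `w_{ab}` of a symplectic form in
coordinates. Skew-symmetry is required everywhere, including outside `T`. -/
structure IsSymplecticMatrix (w : E d → Matrix (Fin d) (Fin d) ℝ) (T : Set (E d)) : Prop where
  isOpen : IsOpen T
  smooth : ∀ a b, ContDiffOn ℝ ∞ (fun y => w y a b) T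
  skew : ∀ y a b, w y a b = -w y b a
  det_ne_zero : ∀ y ∈ T, (w y).det ≠ 0
  closed : ∀ y ∈ T, ∀ i a b, fderiv ℝ (fun z => w z a b) y (e i) +
    fderiv ℝ (fun z => w z b i) y (e a) + fderiv ℝ (fun z => w z i a) y (e b) = 0

/-- The Liouville density `|det w|^{1/2}`, where the determinant is nonzero. The logarithm of `Real`
is even, so the sign of the determinant plays no role, and the value is positive everywhere. -/
noncomputable def density (w : E d → Matrix (Fin d) (Fin d) ℝ) (y : E d) : ℝ :=
  Real.exp (1 / 2 * Real.log (w y).det)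

theorem density_pos (w : E d → Matrix (Fin d) (Fin d) ℝ) (y : E d) : 0 < density w y :=
  Real.exp_pos _

namespace IsSymplecticMatrix

variable {w : E d → Matrix (Fin d) (Fin d) ℝ} {T : Set (E d)} (hw : IsSymplecticMatrix w T)
include hw

theorem inv_skew {y : E d} (hy : y ∈ T) (a b : Fin d) : (w y)⁻¹ a b = -(w y)⁻¹ b a := by
  have h1 : (w y)ᵀ = -w y := by
    ext i j
    rw [transpose_apply, Matrix.neg_apply, hw.skew]
  have h2 : ((w y)⁻¹)ᵀ = -(w y)⁻¹ := by
    rw [transpose_nonsing_inv, h1]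
    refine inv_eq_right_inv ?_
    rw [neg_mul_neg, mul_nonsing_inv _ (isUnit_iff_ne_zero.mpr (hw.det_ne_zero y hy))]
  have := congrFun (congrFun h2 b) a
  rw [transpose_apply, Matrix.neg_apply] at this
  exact this

theorem contDiffOn_inv (a b : Fin d) : ContDiffOn ℝ ∞ (fun y => (w y)⁻¹ a b) T :=
  StarTrace.contDiffOn_inv hw.smooth hw.det_ne_zero a b

theorem contDiffOn_density : ContDiffOn ℝ ∞ (density w) T := by
  unfold density
  exact (contDiffOn_const.mul ((contDiffOn_det hw.smooth).log hw.det_ne_zero)).exp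

theorem hasDerivAt_line {V : Type*} [NormedAddCommGroup V] [NormedSpace ℝ V] {f : E d → V}
    (hf : ContDiffOn ℝ ∞ f T) {y : E d} (hy : y ∈ T) (i : Fin d) :
    HasDerivAt (fun t : ℝ => f (y + t • (e i : E d))) (fderiv ℝ f y (e i)) 0 :=
  ((hf.contDiffAt (hw.isOpen.mem_nhds hy)).differentiableAt (by simp)).hasFDerivAt.hasLineDerivAt _

theorem fderiv_inv {y : E d} (hy : y ∈ T) (i p q : Fin d) :
    fderiv ℝ (fun z => (w z)⁻¹ p q) y (e i) =
      -∑ a, ∑ b, (w y)⁻¹ p a * fderiv ℝ (fun z => w z a b) y (e i) * (w y)⁻¹ b q := by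
  set w' : Matrix (Fin d) (Fin d) ℝ := Matrix.of fun a b => fderiv ℝ (fun z => w z a b) y (e i)
  set p' : Matrix (Fin d) (Fin d) ℝ :=
    Matrix.of fun a b => fderiv ℝ (fun z => (w z)⁻¹ a b) y (e i)
  have hd : IsUnit (w y).det := isUnit_iff_ne_zero.mpr (hw.det_ne_zero y hy)
  have key : w' * (w y)⁻¹ + w y * p' = 0 := by
    ext a c
    have h1 : HasDerivAt (fun t : ℝ => ∑ b, w (y + t • (e i : E d)) a b *
        (w (y + t • (e i : E d)))⁻¹ b c) (∑ b, (w' a b * (w y)⁻¹ b c + w y a b * p' b c)) 0 := by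
      refine HasDerivAt.fun_sum fun b _ => ?_
      refine ((hw.hasDerivAt_line (hw.smooth a b) hy i).fun_mul
        (hw.hasDerivAt_line (hw.contDiffOn_inv b c) hy i)).congr_deriv ?_
      simp only [zero_smul, add_zero]
      rfl
    have h2 : HasDerivAt (fun t : ℝ => ∑ b, w (y + t • (e i : E d)) a b *
        (w (y + t • (e i : E d)))⁻¹ b c) 0 0 := by
      refine (hasDerivAt_const (0 : ℝ) ((1 : Matrix (Fin d) (Fin d) ℝ) a c)).congr_of_eventuallyEq ?_
      have hc : Filter.Tendsto (fun t : ℝ => y + t • (e i : E d)) (𝓝 0) (𝓝 y) := by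
        have : Continuous fun t : ℝ => y + t • (e i : E d) := by fun_prop
        simpa using this.tendsto 0
      filter_upwards [hc.eventually (hw.isOpen.mem_nhds hy)] with t ht
      rw [← mul_nonsing_inv _ (isUnit_iff_ne_zero.mpr (hw.det_ne_zero _ ht))]
      rfl
    have h3 := h1.unique h2
    rw [Finset.sum_add_distrib] at h3
    exact h3
  have h4 : p' = -((w y)⁻¹ * w' * (w y)⁻¹) := by
    have := congrArg (fun m => (w y)⁻¹ * m) key
    simp only [Matrix.mul_add, Matrix.mul_zero] at this
    rw [← Matrix.mul_assoc _ (w y), nonsing_inv_mul _ hd, Matrix.one_mul, ← Matrix.mul_assoc] at this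
    exact eq_neg_of_add_eq_zero_right this
  have h5 := congrFun (congrFun h4 p) q
  simp only [Matrix.neg_apply, Matrix.mul_apply, Finset.sum_mul] at h5
  rw [Finset.sum_comm] at h5
  exact h5

theorem fderiv_density {y : E d} (hy : y ∈ T) (i : Fin d) :
    fderiv ℝ (density w) y (e i) =
      density w y * (1 / 2 * ∑ a, ∑ b, (w y)⁻¹ a b * fderiv ℝ (fun z => w z b a) y (e i)) := by
  refine (hw.hasDerivAt_line hw.contDiffOn_density hy i).unique ?_
  have h1 := hasDerivAt_det (A := fun t : ℝ => w (y + t • (e i : E d)))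
    (A' := Matrix.of fun a b => fderiv ℝ (fun z => w z a b) y (e i)) (t := 0)
    fun a b => hw.hasDerivAt_line (hw.smooth a b) hy i
  have hne : (w (y + (0 : ℝ) • (e i : E d))).det ≠ 0 := by simpa using hw.det_ne_zero y hy
  have h2 := ((h1.log hne).const_mul (1 / 2 : ℝ)).exp
  refine h2.congr_deriv ?_
  simp only [zero_smul, add_zero, inv_def, Matrix.smul_apply, Ring.inverse_eq_inv', smul_eq_mul, density,
    Matrix.of_apply]
  rw [Finset.sum_div]
  congr 2
  refine Finset.sum_congr rfl fun a _ => ?_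
  rw [Finset.sum_div]
  refine Finset.sum_congr rfl fun b _ => ?_
  ring

/-- Contraction of `dω = 0` with the Poisson tensor: it rewrites the logarithmic derivative of the
Liouville density as the term that cancels the derivatives of `w⁻¹` in Liouville's theorem. -/
theorem contract_closed {y : E d} (hy : y ∈ T) (c : Fin d) :
    1 / 2 * ∑ a, ∑ b, (w y)⁻¹ a b * fderiv ℝ (fun z => w z b a) y (e c) =
      ∑ a, ∑ b, (w y)⁻¹ a b * fderiv ℝ (fun z => w z b c) y (e a) := by
  have hsk : ∀ a b (v : E d), fderiv ℝ (fun z => w z a b) y v = -fderiv ℝ (fun z => w z b a) y v := by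
    intro a b v
    have : (fun z => w z a b) = fun z => -w z b a := by ext z; exact hw.skew z a b
    rw [this, fderiv_fun_neg]
    rfl
  have h1 : ∑ a, ∑ b, (w y)⁻¹ a b * fderiv ℝ (fun z => w z c a) y (e b) =
      ∑ a, ∑ b, (w y)⁻¹ a b * fderiv ℝ (fun z => w z b c) y (e a) := by
    rw [Finset.sum_comm]
    refine Finset.sum_congr rfl fun a _ => Finset.sum_congr rfl fun b _ => ?_
    rw [hw.inv_skew hy, hsk c b]
    ring
  have h2 : ∑ a, ∑ b, (w y)⁻¹ a b * (fderiv ℝ (fun z => w z b c) y (e a) +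
      fderiv ℝ (fun z => w z c a) y (e b) + fderiv ℝ (fun z => w z a b) y (e c)) = 0 := by
    refine Finset.sum_eq_zero fun a _ => Finset.sum_eq_zero fun b _ => ?_
    rw [hw.closed y hy a b c, mul_zero]
  simp only [mul_add, Finset.sum_add_distrib] at h2
  rw [h1] at h2
  have h3 : ∑ a, ∑ b, (w y)⁻¹ a b * fderiv ℝ (fun z => w z b a) y (e c) =
      -∑ a, ∑ b, (w y)⁻¹ a b * fderiv ℝ (fun z => w z a b) y (e c) := by
    simp only [← Finset.sum_neg_distrib]
    refine Finset.sum_congr rfl fun a _ => Finset.sum_congr rfl fun b _ => ?_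
    rw [hsk b a]; ring
  rw [h3]
  linarith

/-- **Liouville's theorem** for the Hamiltonian vector fields of the coordinate functions. -/
theorem sum_fderiv_density_mul_inv {y : E d} (hy : y ∈ T) (k : Fin d) :
    ∑ i, fderiv ℝ (fun z => density w z * (w z)⁻¹ i k) y (e i) = 0 := by
  have hT := hw.isOpen.mem_nhds hy
  have h1 : ∀ i, fderiv ℝ (fun z => density w z * (w z)⁻¹ i k) y (e i) =
      density w y * ((∑ a, ∑ b, (w y)⁻¹ a b * fderiv ℝ (fun z => w z b i) y (e a)) * (w y)⁻¹ i k)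
      - density w y * ∑ a, ∑ b, (w y)⁻¹ i a * fderiv ℝ (fun z => w z a b) y (e i) * (w y)⁻¹ b k := by
    intro i
    rw [fderiv_fun_mul ((hw.contDiffOn_density.contDiffAt hT).differentiableAt (by simp))
      (((hw.contDiffOn_inv i k).contDiffAt hT).differentiableAt (by simp))]
    simp only [_root_.add_apply, _root_.smul_apply, smul_eq_mul]
    rw [hw.fderiv_inv hy, hw.fderiv_density hy, hw.contract_closed hy]
    ring
  simp only [h1, Finset.sum_sub_distrib, ← Finset.mul_sum]
  rw [← mul_sub]
  convert mul_zero _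
  rw [sub_eq_zero]
  simp only [Finset.sum_mul]
  rw [Finset.sum_comm]
  refine Finset.sum_congr rfl fun a _ => ?_
  rw [Finset.sum_comm]

/-- **Liouville's theorem**: Hamiltonian vector fields have divergence zero. -/
theorem sum_fderiv_hamiltonian {y : E d} (hy : y ∈ T) {β : E d → ℝ} (hβ : ContDiffOn ℝ ∞ β T) :
    ∑ i, fderiv ℝ (fun z => ∑ k, density w z * (w z)⁻¹ i k * fderiv ℝ β z (e k)) y (e i) = 0 := by
  have hT := hw.isOpen.mem_nhds hy
  have hβ' : ContDiffAt ℝ ∞ β y := hβ.contDiffAt hT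
  have hdβ : DifferentiableAt ℝ (fderiv ℝ β) y :=
    (hβ'.fderiv_right (m := ∞) (by simp)).differentiableAt (by simp)
  have hd : ∀ i k, DifferentiableAt ℝ (fun z => density w z * (w z)⁻¹ i k) y := fun i k =>
    ((hw.contDiffOn_density.contDiffAt hT).differentiableAt (by simp)).mul
      (((hw.contDiffOn_inv i k).contDiffAt hT).differentiableAt (by simp))
  have hk : ∀ k, DifferentiableAt ℝ (fun z => fderiv ℝ β z (e k)) y := fun k =>
    hdβ.clm_apply (differentiableAt_const _)
  have h1 : ∀ i, fderiv ℝ (fun z => ∑ k, density w z * (w z)⁻¹ i k * fderiv ℝ β z (e k)) y (e i) =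
      ∑ k, (density w y * ((w y)⁻¹ i k * fderiv ℝ (fderiv ℝ β) y (e i) (e k)) +
        fderiv ℝ β y (e k) * fderiv ℝ (fun z => density w z * (w z)⁻¹ i k) y (e i)) := by
    intro i
    rw [fderiv_fun_sum (u := Finset.univ)
      (A := fun k z => density w z * (w z)⁻¹ i k * fderiv ℝ β z (e k))
      fun k _ => (hd i k).fun_mul (hk k), _root_.sum_apply]
    refine Finset.sum_congr rfl fun k _ => ?_
    rw [fderiv_fun_mul (hd i k) (hk k), fderiv_clm_apply hdβ (differentiableAt_const _)]
    simp
    ring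
  simp only [h1, Finset.sum_add_distrib]
  have h2 : ∑ i, ∑ k, fderiv ℝ β y (e k) * fderiv ℝ (fun z => density w z * (w z)⁻¹ i k) y (e i)
      = 0 := by
    rw [Finset.sum_comm]
    refine Finset.sum_eq_zero fun k _ => ?_
    rw [← Finset.mul_sum, hw.sum_fderiv_density_mul_inv hy, mul_zero]
  rw [h2, add_zero]
  simp only [← Finset.mul_sum]
  convert mul_zero _
  have hsym : IsSymmSndFDerivAt ℝ β y := hβ'.isSymmSndFDerivAt (by
    simp; exact WithTop.coe_le_coe.mpr le_top)
  -- a skew matrix contracted with a symmetric one, the second derivative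
  have h3 : ∑ i, ∑ k, (w y)⁻¹ i k * fderiv ℝ (fderiv ℝ β) y (e i) (e k) =
      -∑ i, ∑ k, (w y)⁻¹ i k * fderiv ℝ (fderiv ℝ β) y (e i) (e k) := by
    conv_lhs => rw [Finset.sum_comm]
    simp only [← Finset.sum_neg_distrib]
    refine Finset.sum_congr rfl fun i _ => Finset.sum_congr rfl fun k _ => ?_
    rw [hw.inv_skew hy, hsym.eq]
    ring
  linarith

/-- The Poisson bracket with `β`, times the Liouville density, is a divergence. -/
theorem density_mul_bracket {y : E d} (hy : y ∈ T) {β : E d → ℝ} (hβ : ContDiffOn ℝ ∞ β T)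
    {a : E d → ℂ} (ha : DifferentiableAt ℝ a y) :
    (density w y : ℂ) * ∑ i, ∑ k, (((w y)⁻¹ i k : ℝ) : ℂ) * fderiv ℝ a y (e i) *
        ((fderiv ℝ β y (e k) : ℝ) : ℂ) =
      ∑ i, fderiv ℝ (fun z =>
        ((∑ k, density w z * (w z)⁻¹ i k * fderiv ℝ β z (e k) : ℝ) : ℂ) * a z) y (e i) := by
  have hT := hw.isOpen.mem_nhds hy
  have hβ' : ContDiffAt ℝ ∞ β y := hβ.contDiffAt hT
  have hdβ : DifferentiableAt ℝ (fderiv ℝ β) y :=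
    (hβ'.fderiv_right (m := ∞) (by simp)).differentiableAt (by simp)
  have hX : ∀ i, DifferentiableAt ℝ
      (fun z => ∑ k, density w z * (w z)⁻¹ i k * fderiv ℝ β z (e k)) y := fun i => by
    refine DifferentiableAt.fun_sum fun k _ => ?_
    exact (((hw.contDiffOn_density.contDiffAt hT).differentiableAt (by simp)).mul
      (((hw.contDiffOn_inv i k).contDiffAt hT).differentiableAt (by simp))).mul
        (hdβ.clm_apply (differentiableAt_const _))
  have h1 : ∀ i, fderiv ℝ (fun z =>
        ((∑ k, density w z * (w z)⁻¹ i k * fderiv ℝ β z (e k) : ℝ) : ℂ) * a z) y (e i) =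
      ((∑ k, density w y * (w y)⁻¹ i k * fderiv ℝ β y (e k) : ℝ) : ℂ) * fderiv ℝ a y (e i) +
      a y * ((fderiv ℝ (fun z => ∑ k, density w z * (w z)⁻¹ i k * fderiv ℝ β z (e k)) y (e i) : ℝ)
        : ℂ) := by
    intro i
    have hc := Complex.ofRealCLM.hasFDerivAt.comp y (hX i).hasFDerivAt
    have := (hc.mul ha.hasFDerivAt).fderiv
    have h2 := congrArg (fun L => L (e i)) this
    exact h2
  simp only [h1, Finset.sum_add_distrib, ← Finset.mul_sum]
  rw [← Complex.ofReal_sum, hw.sum_fderiv_hamiltonian hy hβ]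
  simp only [Complex.ofReal_zero, mul_zero, add_zero, Finset.mul_sum, Complex.ofReal_sum,
    Finset.sum_mul, Complex.ofReal_mul]
  refine Finset.sum_congr rfl fun i _ => Finset.sum_congr rfl fun k _ => ?_
  ring

end IsSymplecticMatrix

end Liouville

/-! ### Sums of Poisson brackets on a cube -/

section LocalSolve

open Matrix MeasureTheory

variable {d : ℕ}

theorem eventually_notMem_cube {y : E d} {r : ℝ} (hr : 0 < r) {z : E d} (hz : z ∉ cube y (2 * r)) :
    ∀ᶠ z' in 𝓝 z, z' ∉ cube y r := by
  obtain ⟨i, hi⟩ := exists_coord_ge_of_notMem_cube hz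
  have : {z' : E d | r < |z' i - y i|} ∈ 𝓝 z :=
    (isOpen_lt continuous_const (by fun_prop)).mem_nhds (by
      simp only [Set.mem_ofPred_eq]; linarith)
  filter_upwards [this] with z' hz' h
  exact absurd (h i) (not_lt.mpr (le_of_lt hz'))

/-- A function smooth on a neighbourhood of a closed cube times a smooth function supported in the
cube is smooth everywhere. -/
theorem contDiff_mul_of_cube {y : E d} {r : ℝ} (hr : 0 < r) {T : Set (E d)} (hT : IsOpen T)
    (hc : cube y (2 * r) ⊆ T) {f : E d → ℝ} (hf : ContDiffOn ℝ ∞ f T) {g : E d → ℂ}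
    (hg : ContDiff ℝ ∞ g) (hg0 : ∀ x ∉ cube y r, g x = 0) :
    ContDiff ℝ ∞ fun z => (f z : ℂ) * g z := by
  rw [contDiff_iff_contDiffAt]
  intro z
  by_cases hz : z ∈ T
  · have h1 : ContDiffAt ℝ ∞ (fun z => (f z : ℂ)) z :=
      Complex.ofRealCLM.contDiff.contDiffAt.comp z (hf.contDiffAt (hT.mem_nhds hz))
    exact h1.mul hg.contDiffAt
  · refine (contDiffAt_const (c := (0 : ℂ))).congr_of_eventuallyEq ?_
    filter_upwards [eventually_notMem_cube hr fun h => hz (hc h)] with z' hz'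
    rw [hg0 z' hz', mul_zero]

/-- If the differentials of the `B j` span the cotangent spaces, every vector field is a
combination, with coefficients depending smoothly on the point, of their Hamiltonian vector fields (times the
Liouville density). -/
theorem IsSymplecticMatrix.exists_rightInverse {w : E d → Matrix (Fin d) (Fin d) ℝ} {T : Set (E d)}
    (hw : IsSymplecticMatrix w T) {ι : Type*} [Fintype ι] {B : ι → E d → ℝ}
    (hB : ∀ j, ContDiffOn ℝ ∞ (B j) T)
    (hspan : ∀ z ∈ T, ∀ v : E d, (∀ j, fderiv ℝ (B j) z v = 0) → v = 0) :
    ∃ R : ι → Fin d → E d → ℝ, (∀ j i, ContDiffOn ℝ ∞ (R j i) T) ∧ ∀ z ∈ T, ∀ i l,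
      ∑ j, (∑ k, density w z * (w z)⁻¹ i k * fderiv ℝ (B j) z (e k)) * R j l z =
        (1 : Matrix (Fin d) (Fin d) ℝ) i l := by
  set A : E d → Matrix (Fin d) ι ℝ := fun z => Matrix.of fun k j => fderiv ℝ (B j) z (e k) with hA
  have hAs : ∀ k j, ContDiffOn ℝ ∞ (fun z => A z k j) T := fun k j => by
    have := (hB j).fderiv_of_isOpen hw.isOpen (m := ∞) (by simp)
    exact this.clm_apply contDiffOn_const
  have hdet : ∀ z ∈ T, (A z * (A z)ᵀ).det ≠ 0 := by
    intro z hz h0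
    obtain ⟨v, hv, hv0⟩ := exists_mulVec_eq_zero_iff.mpr h0
    apply hv
    have h1 : (A z)ᵀ *ᵥ v = 0 := by
      rw [← dotProduct_self_eq_zero, dotProduct_mulVec, vecMul_transpose, mulVec_mulVec, hv0,
        zero_dotProduct]
    have h2 : (WithLp.toLp 2 v : E d) = 0 := by
      refine hspan z hz _ fun j => ?_
      rw [eq_sum_smul_e (WithLp.toLp 2 v : E d), map_sum]
      have := congrFun h1 j
      simp only [mulVec, dotProduct, transpose_apply, Pi.zero_apply] at this
      rw [← this]
      refine Finset.sum_congr rfl fun k _ => ?_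
      rw [map_smul, smul_eq_mul, mul_comm]
      rfl
    simpa using h2
  have hGs : ∀ a b, ContDiffOn ℝ ∞ (fun z => (A z * (A z)ᵀ) a b) T := fun a b => by
    simp only [mul_apply, transpose_apply]
    exact ContDiffOn.sum fun j _ => (hAs a j).mul (hAs b j)
  -- with `A` the matrix of the differentials, `w⁻¹ A` has the right inverse `Aᵀ (A Aᵀ)⁻¹ w`
  refine ⟨fun j i z => (density w z)⁻¹ * ((A z)ᵀ * (A z * (A z)ᵀ)⁻¹ * w z) j i, fun j i => ?_,
    fun z hz i l => ?_⟩
  · refine (hw.contDiffOn_density.inv fun z _ => (density_pos w z).ne').mul ?_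
    simp only [mul_apply, transpose_apply]
    refine ContDiffOn.sum fun a _ => ContDiffOn.mul (ContDiffOn.sum fun b _ => (hAs b j).mul ?_)
      (hw.smooth a i)
    exact StarTrace.contDiffOn_inv hGs hdet b a
  · have h1 : (w z)⁻¹ * A z * ((A z)ᵀ * (A z * (A z)ᵀ)⁻¹ * w z) = 1 := by
      rw [Matrix.mul_assoc, ← Matrix.mul_assoc (A z), ← Matrix.mul_assoc (A z),
        mul_nonsing_inv _ (isUnit_iff_ne_zero.mpr (hdet z hz)), Matrix.one_mul,
        nonsing_inv_mul _ (isUnit_iff_ne_zero.mpr (hw.det_ne_zero z hz))]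
    rw [← h1, mul_apply]
    refine Finset.sum_congr rfl fun j _ => ?_
    have h2 : ∑ k, density w z * (w z)⁻¹ i k * fderiv ℝ (B j) z (e k) =
        density w z * ((w z)⁻¹ * A z) i j := by
      rw [mul_apply, Finset.mul_sum]
      refine Finset.sum_congr rfl fun k _ => ?_
      rw [mul_assoc]
      rfl
    rw [h2]
    have := (density_pos w z).ne'
    field_simp

/-- A function which is supported in a cube in a coordinate domain and whose Liouville integral
vanishes is a sum of Poisson brackets with prescribed functions whose differentials span. -/
theorem IsSymplecticMatrix.exists_bracket_eq {w : E d → Matrix (Fin d) (Fin d) ℝ} {T : Set (E d)}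
    (hw : IsSymplecticMatrix w T) {ι : Type*} [Fintype ι] {B : ι → E d → ℝ}
    (hB : ∀ j, ContDiffOn ℝ ∞ (B j) T)
    (hspan : ∀ z ∈ T, ∀ v : E d, (∀ j, fderiv ℝ (B j) z v = 0) → v = 0)
    {y : E d} {r : ℝ} (hr : 0 < r) (hc : cube y (2 * r) ⊆ T)
    {F : E d → ℂ} (hF : ContDiff ℝ ∞ F) (hF0 : ∀ x ∉ cube y r, F x = 0)
    (hint : ∫ z, (density w z : ℂ) * F z = 0) :
    ∃ a : ι → E d → ℂ, (∀ j, ContDiff ℝ ∞ (a j)) ∧ (∀ j, ∀ x ∉ cube y r, a j x = 0) ∧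
      ∀ z ∈ T, F z = ∑ j, ∑ i, ∑ k, (((w z)⁻¹ i k : ℝ) : ℂ) * fderiv ℝ (a j) z (e i) *
        ((fderiv ℝ (B j) z (e k) : ℝ) : ℂ) := by
  obtain ⟨R, hR, hXR⟩ := hw.exists_rightInverse hB hspan
  obtain ⟨G, hG, hG0, hFG⟩ := exists_divergence_eq hr
    (contDiff_mul_of_cube hr hw.isOpen hc hw.contDiffOn_density hF hF0)
    (fun x hx => by rw [hF0 x hx, mul_zero]) hint
  set a : ι → E d → ℂ := fun j z => ∑ l, (R j l z : ℂ) * G l z with ha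
  have has : ∀ j, ContDiff ℝ ∞ (a j) := fun j => ContDiff.sum fun l _ =>
    contDiff_mul_of_cube hr hw.isOpen hc (hR j l) (hG l) (hG0 l)
  refine ⟨a, has, fun j x hx => Finset.sum_eq_zero fun l _ => by rw [hG0 l x hx, mul_zero],
    fun z hz => ?_⟩
  have hD : (density w z : ℂ) ≠ 0 := by
    exact_mod_cast (density_pos w z).ne'
  apply mul_left_cancel₀ hD
  rw [hFG z, Finset.mul_sum]
  have h1 : ∀ j, (density w z : ℂ) * ∑ i, ∑ k, (((w z)⁻¹ i k : ℝ) : ℂ) * fderiv ℝ (a j) z (e i) *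
        ((fderiv ℝ (B j) z (e k) : ℝ) : ℂ) = _ := fun j =>
    hw.density_mul_bracket hz (hB j) ((has j).differentiable (by simp) z)
  simp only [h1]
  rw [Finset.sum_comm]
  refine Finset.sum_congr rfl fun i _ => ?_
  have h2 : G i =ᶠ[𝓝 z] fun z => ∑ j,
      ((∑ k, density w z * (w z)⁻¹ i k * fderiv ℝ (B j) z (e k) : ℝ) : ℂ) * a j z := by
    filter_upwards [hw.isOpen.mem_nhds hz] with z' hz'
    simp only [ha, Finset.mul_sum]
    rw [Finset.sum_comm]
    have h3 : ∀ l, ∑ j, ((∑ k, density w z' * (w z')⁻¹ i k * fderiv ℝ (B j) z' (e k) : ℝ) : ℂ) *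
        ((R j l z' : ℂ) * G l z') = (((1 : Matrix (Fin d) (Fin d) ℝ) i l : ℝ) : ℂ) * G l z' := by
      intro l
      rw [← hXR z' hz' i l, Complex.ofReal_sum, Finset.sum_mul]
      refine Finset.sum_congr rfl fun j _ => ?_
      rw [Complex.ofReal_mul, mul_assoc]
    simp only [h3]
    rw [Finset.sum_eq_single i]
    · simp
    · intro l _ hl
      rw [Matrix.one_apply_ne hl.symm]
      simp
    · simp
  rw [h2.fderiv_eq, fderiv_fun_sum, _root_.sum_apply]
  intro j _
  have hX : ContDiffOn ℝ ∞ (fun z => ∑ k, density w z * (w z)⁻¹ i k * fderiv ℝ (B j) z (e k)) T := by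
    refine ContDiffOn.sum fun k _ => (hw.contDiffOn_density.mul (hw.contDiffOn_inv i k)).mul ?_
    exact ((hB j).fderiv_of_isOpen hw.isOpen (m := ∞) (by simp)).clm_apply contDiffOn_const
  have hXd := (hX.contDiffAt (hw.isOpen.mem_nhds hz)).differentiableAt (by simp)
  have hXc : DifferentiableAt ℝ (fun z =>
      ((∑ k, density w z * (w z)⁻¹ i k * fderiv ℝ (B j) z (e k) : ℝ) : ℂ)) z :=
    Complex.ofRealCLM.differentiableAt.comp z hXd
  exact hXc.mul ((has j).differentiable (by simp) z)

/-- The Liouville integral of a nonnegative, not identically vanishing function `H` supported in a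
cube is nonzero, so that every function supported in the cube is a multiple of `H`, up to sums of
brackets. -/
theorem IsSymplecticMatrix.exists_eq_add_bracket {w : E d → Matrix (Fin d) (Fin d) ℝ}
    {T : Set (E d)} (hw : IsSymplecticMatrix w T) {ι : Type*} [Fintype ι] {B : ι → E d → ℝ}
    (hB : ∀ j, ContDiffOn ℝ ∞ (B j) T)
    (hspan : ∀ z ∈ T, ∀ v : E d, (∀ j, fderiv ℝ (B j) z v = 0) → v = 0)
    {y : E d} {r : ℝ} (hr : 0 < r) (hc : cube y (2 * r) ⊆ T)
    {H : E d → ℂ} (hH : ContDiff ℝ ∞ H) (hH0 : ∀ x ∉ cube y r, H x = 0)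
    (hHnn : ∀ x, 0 ≤ (H x).re) (hHre : ∃ x, (H x).re ≠ 0)
    {F : E d → ℂ} (hF : ContDiff ℝ ∞ F) (hF0 : ∀ x ∉ cube y r, F x = 0) :
    ∃ (c : ℂ) (a : ι → E d → ℂ), (∀ j, ContDiff ℝ ∞ (a j)) ∧ (∀ j, ∀ x ∉ cube y r, a j x = 0) ∧
      ∀ z ∈ T, F z = c * H z + ∑ j, ∑ i, ∑ k, (((w z)⁻¹ i k : ℝ) : ℂ) * fderiv ℝ (a j) z (e i) *
        ((fderiv ℝ (B j) z (e k) : ℝ) : ℂ) := by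
  have hDs : ∀ {K : E d → ℂ}, ContDiff ℝ ∞ K → (∀ x ∉ cube y r, K x = 0) →
      Integrable fun z => (density w z : ℂ) * K z := fun hK hK0 =>
    (contDiff_mul_of_cube hr hw.isOpen hc hw.contDiffOn_density hK
      hK0).continuous.integrable_of_hasCompactSupport
      (hasCompactSupport_of_cube (y := y) (r := r) fun x hx => by rw [hK0 x hx, mul_zero])
  have hpos : (∫ z, (density w z : ℂ) * H z) ≠ 0 := by
    intro h0
    have h1 : ∫ z, density w z * (H z).re = 0 := by
      have h2 : (∫ z, ((density w z : ℂ) * H z)).re = ∫ z, ((density w z : ℂ) * H z).re :=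
        (integral_re (𝕜 := ℂ) (hDs hH hH0)).symm
      rw [h0] at h2
      simpa using h2.symm
    have h3 : 0 < ∫ z, density w z * (H z).re := by
      have hcont : Continuous fun z => density w z * (H z).re := by
        have := Complex.continuous_re.comp
          (contDiff_mul_of_cube hr hw.isOpen hc hw.contDiffOn_density hH hH0).continuous
        refine this.congr fun z => ?_
        simp
      refine hcont.integral_pos_of_hasCompactSupport_nonneg_nonzero
        (x := hHre.choose) ?_ ?_ ?_
      · exact hasCompactSupport_of_cube (y := y) (r := r) fun x hx => by rw [hH0 x hx]; simp
      · exact fun z => mul_nonneg (density_pos w z).le (hHnn z)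
      · exact mul_ne_zero (density_pos w _).ne' hHre.choose_spec
    exact h3.ne' h1
  set c := (∫ z, (density w z : ℂ) * F z) / ∫ z, (density w z : ℂ) * H z with hcdef
  obtain ⟨a, ha, ha0, hFa⟩ := hw.exists_bracket_eq hB hspan hr hc (F := fun z => F z - c * H z)
    (hF.sub (contDiff_const.mul hH)) (fun x hx => by rw [hF0 x hx, hH0 x hx]; simp) (by
      have h1 : ∀ z, (density w z : ℂ) * (F z - c * H z) =
          (density w z : ℂ) * F z - c * ((density w z : ℂ) * H z) := fun z => by ring
      rw [integral_congr_ae (Filter.Eventually.of_forall h1),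
        integral_sub (hDs hF hF0) ((hDs hH hH0).const_mul c), integral_const_mul, hcdef,
        div_mul_cancel₀ _ hpos, sub_self])
  refine ⟨c, a, ha, ha0, fun z hz => ?_⟩
  rw [← hFa z hz]
  ring

end LocalSolve

/-! ### The Poisson bracket in a chart -/

section Chart

open Matrix

variable {d : ℕ} {M : Type*} [TopologicalSpace M] [ChartedSpace (E d) M]

theorem update_pair_zero (v u w : E d) : Function.update ![v, u] 0 w = ![w, u] := by
  ext i
  fin_cases i <;> simp

theorem update_pair_one (v u w : E d) : Function.update ![v, u] 1 w = ![v, w] := by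
  ext i
  fin_cases i <;> simp

/-- An alternating 2-form as a bilinear map. -/
noncomputable def bilin (f : (E d) [⋀^Fin 2]→L[ℝ] ℝ) : E d →ₗ[ℝ] E d →ₗ[ℝ] ℝ :=
  LinearMap.mk₂ ℝ (fun v u => f ![v, u])
    (fun v v' u => by
      have := f.toMultilinearMap.map_update_add ![0, u] 0 v v'
      rwa [update_pair_zero, update_pair_zero, update_pair_zero] at this)
    (fun c v u => by
      have := f.toMultilinearMap.map_update_smul ![0, u] 0 c v
      rwa [update_pair_zero, update_pair_zero] at this)
    (fun v u u' => by
      have := f.toMultilinearMap.map_update_add ![v, 0] 1 u u'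
      rwa [update_pair_one, update_pair_one, update_pair_one] at this)
    (fun c v u => by
      have := f.toMultilinearMap.map_update_smul ![v, 0] 1 c u
      rwa [update_pair_one, update_pair_one] at this)

theorem bilin_apply (f : (E d) [⋀^Fin 2]→L[ℝ] ℝ) (v u : E d) : bilin f v u = f ![v, u] := rfl

theorem bilin_swap (f : (E d) [⋀^Fin 2]→L[ℝ] ℝ) (v u : E d) : bilin f v u = -bilin f u v := by
  have h := f.toAlternatingMap.map_swap ![u, v] (i := 0) (j := 1) (by simp)
  have h2 : ![u, v] ∘ Equiv.swap (0 : Fin 2) 1 = ![v, u] := by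
    ext i
    fin_cases i <;> simp
  rw [h2] at h
  exact h

theorem bilin_eq_sum (f : (E d) [⋀^Fin 2]→L[ℝ] ℝ) (v u : E d) :
    bilin f v u = ∑ a, ∑ b, v a * u b * bilin f (e a) (e b) := by
  conv_lhs => rw [eq_sum_smul_e v, eq_sum_smul_e u]
  simp only [map_sum, map_smul, LinearMap.sum_apply, LinearMap.smul_apply, smul_eq_mul]
  simp only [Finset.mul_sum]
  rw [Finset.sum_comm]
  refine Finset.sum_congr rfl fun a _ => Finset.sum_congr rfl fun b _ => ?_
  ring

theorem sum_comm_four {ι R : Type*} [Fintype ι] [AddCommMonoid R] (f : ι → ι → ι → ι → R) :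
    ∑ a, ∑ b, ∑ k, ∑ i, f a b k i = ∑ i, ∑ k, ∑ b, ∑ a, f a b k i := by
  have h1 : ∀ a, ∑ b, ∑ k, ∑ i, f a b k i = ∑ i, ∑ k, ∑ b, f a b k i := fun a => by
    rw [Finset.sum_comm]
    conv_lhs => enter [2, k]; rw [Finset.sum_comm]
    rw [Finset.sum_comm]
  simp only [h1]
  rw [Finset.sum_comm]
  refine Finset.sum_congr rfl fun i _ => ?_
  rw [Finset.sum_comm]
  refine Finset.sum_congr rfl fun k _ => ?_
  rw [Finset.sum_comm]

/-- The matrix of a 2-form in the chart at `x₀`. -/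
noncomputable def chartMatrix (Ω : TwoForm d M) (x₀ : M) (y : E d) : Matrix (Fin d) (Fin d) ℝ :=
  Matrix.of fun i j => bilin (Ω.inChart x₀ y) (e i) (e j)

/-- The form at a point, on the model space, with which `T_x M` agrees by definition. -/
noncomputable def formAt (Ω : TwoForm d M) (x : M) : (E d) [⋀^Fin 2]→L[ℝ] ℝ := Ω x

/-- The differential of the inverse of the chart at `x₀`, on the model space. -/
noncomputable def chartDiff (x₀ : M) (y : E d) : E d →L[ℝ] E d :=
  mfderiv 𝓘(ℝ, E d) (𝓡 d) (extChartAt (𝓡 d) x₀).symm y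

/-- The differential of a function at a point, on the model space. -/
noncomputable def diffAt {F : Type*} [NormedAddCommGroup F] [NormedSpace ℝ F] (f : M → F) (x : M) :
    E d →L[ℝ] F :=
  mfderiv (𝓡 d) 𝓘(ℝ, F) f x

theorem bilin_inChart (Ω : TwoForm d M) (x₀ : M) (y v u : E d) :
    bilin (Ω.inChart x₀ y) v u =
      bilin (formAt Ω ((extChartAt (𝓡 d) x₀).symm y)) (chartDiff x₀ y v) (chartDiff x₀ y u) := by
  rw [bilin_apply, bilin_apply]
  change formAt Ω ((extChartAt (𝓡 d) x₀).symm y) (fun k => chartDiff x₀ y (![v, u] k)) = _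
  congr 1
  ext k
  fin_cases k <;> rfl

theorem matrix_apply (Ω : TwoForm d M) (x : M) (i j : Fin d) :
    Ω.matrix x i j = bilin (formAt Ω x) (e i) (e j) := rfl

theorem IsSymplectic.eq_zero_of_bilin {Ω : TwoForm d M} (hΩ : IsSymplectic Ω) (x : M) (v : E d)
    (h : ∀ u, bilin (formAt Ω x) v u = 0) : v = 0 :=
  hΩ.nondegenerate x v h

variable [IsManifold (𝓡 d) ∞ M]

theorem mdifferentiableAt_chart_symm {x₀ : M} {y : E d} (hy : y ∈ (extChartAt (𝓡 d) x₀).target) :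
    MDifferentiableAt 𝓘(ℝ, E d) (𝓡 d) (extChartAt (𝓡 d) x₀).symm y :=
  ((contMDiffOn_extChartAt_symm (n := ∞) x₀).contMDiffAt
    ((isOpen_extChartAt_target x₀).mem_nhds hy)).mdifferentiableAt (by simp)

theorem chartDiff_bijective {x₀ : M} {y : E d}
    (hy : y ∈ (extChartAt (𝓡 d) x₀).target) :
    Function.Bijective (chartDiff x₀ y) := by
  have := isInvertible_mfderivWithin_extChartAt_symm (I := 𝓡 d) hy
  rw [ModelWithCorners.range_eq_univ, mfderivWithin_univ] at this
  exact this.bijective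

theorem fderiv_comp_chart_symm {x₀ : M} {y : E d} (hy : y ∈ (extChartAt (𝓡 d) x₀).target)
    {F : Type*} [NormedAddCommGroup F] [NormedSpace ℝ F] {f : M → F}
    (hf : MDifferentiableAt (𝓡 d) 𝓘(ℝ, F) f ((extChartAt (𝓡 d) x₀).symm y)) (v : E d) :
    fderiv ℝ (f ∘ (extChartAt (𝓡 d) x₀).symm) y v =
      diffAt f ((extChartAt (𝓡 d) x₀).symm y) (chartDiff x₀ y v) := by
  have h1 := mfderiv_comp y hf (mdifferentiableAt_chart_symm hy)
  have h2 : fderiv ℝ (f ∘ (extChartAt (𝓡 d) x₀).symm) y =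
    mfderiv 𝓘(ℝ, E d) 𝓘(ℝ, F) (f ∘ (extChartAt (𝓡 d) x₀).symm) y := mfderiv_eq_fderiv.symm
  rw [h2]
  exact congrArg (fun L : E d →L[ℝ] F => L v) h1

theorem IsSymplectic.isSymplecticMatrix {Ω : TwoForm d M} (hΩ : IsSymplectic Ω) (x₀ : M) :
    IsSymplecticMatrix (chartMatrix Ω x₀) (extChartAt (𝓡 d) x₀).target where
  isOpen := isOpen_extChartAt_target x₀
  smooth a b := by
    have := (ContinuousAlternatingMap.apply ℝ (E d) ℝ
      (![e a, e b] : Fin 2 → E d)).contDiff.comp_contDiffOn (hΩ.smooth x₀)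
    exact this
  skew y a b := bilin_swap (Ω.inChart x₀ y) (e a) (e b)
  det_ne_zero y hy h0 := by
    obtain ⟨v, hv, hv0⟩ := exists_vecMul_eq_zero_iff.mpr h0
    apply hv
    have h1 : ∀ u, bilin (Ω.inChart x₀ y) (WithLp.toLp 2 v) u = 0 := by
      intro u
      rw [bilin_eq_sum, Finset.sum_comm]
      refine Finset.sum_eq_zero fun b _ => ?_
      have := congrFun hv0 b
      simp only [vecMul, dotProduct, chartMatrix, of_apply, Pi.zero_apply] at this
      rw [← mul_zero (u b), ← this, Finset.mul_sum]
      refine Finset.sum_congr rfl fun a _ => ?_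
      ring
    have hb := chartDiff_bijective hy
    have h2 := hΩ.eq_zero_of_bilin _ (chartDiff x₀ y (WithLp.toLp 2 v)) (by
        intro u
        obtain ⟨u', rfl⟩ := hb.2 u
        rw [← bilin_inChart]
        exact h1 u')
    have h4 : (WithLp.toLp 2 v : E d) = 0 := hb.1 (h2.trans (map_zero _).symm)
    simpa using h4
  closed y hy i a b := by
    have hd : DifferentiableAt ℝ (Ω.inChart x₀) y :=
      ((hΩ.smooth x₀).contDiffAt ((isOpen_extChartAt_target x₀).mem_nhds hy)).differentiableAt
        (by simp)
    have h0 := hΩ.closed x₀ y hy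
    have h1 := extDeriv_apply hd ![e i, e a, e b]
    rw [h0, Fin.sum_univ_three] at h1
    have hm : ∀ (k : Fin 3) (p q : Fin d), k.removeNth ![(e i : E d), e a, e b] = ![e p, e q] →
        (fun z => Ω.inChart x₀ z (k.removeNth ![(e i : E d), e a, e b])) =
          fun z => chartMatrix Ω x₀ z p q := fun k p q h => by rw [h]; rfl
    rw [hm 0 a b (by ext k; fin_cases k <;> rfl), hm 1 i b (by ext k; fin_cases k <;> rfl),
      hm 2 i a (by ext k; fin_cases k <;> rfl)] at h1
    have hs : (fun z => chartMatrix Ω x₀ z b i) = fun z => -chartMatrix Ω x₀ z i b := by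
      ext z; exact bilin_swap (Ω.inChart x₀ z) (e b) (e i)
    rw [hs, fderiv_fun_neg]
    simp at h1 ⊢
    linarith

/-- The Poisson bracket in the chart at `x₀`. It is defined at each point by the chart at that
point, so the statement is its invariance under changes of coordinates. -/
theorem poisson_eq_chart {Ω : TwoForm d M} (hΩ : IsSymplectic Ω) {x₀ : M} {y : E d}
    (hy : y ∈ (extChartAt (𝓡 d) x₀).target) {u v : M → ℂ}
    (hu : MDifferentiableAt (𝓡 d) 𝓘(ℝ, ℂ) u ((extChartAt (𝓡 d) x₀).symm y))
    (hv : MDifferentiableAt (𝓡 d) 𝓘(ℝ, ℂ) v ((extChartAt (𝓡 d) x₀).symm y)) :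
    poisson Ω u v ((extChartAt (𝓡 d) x₀).symm y) =
      ∑ i, ∑ k, (((chartMatrix Ω x₀ y)⁻¹ i k : ℝ) : ℂ) *
        fderiv ℝ (u ∘ (extChartAt (𝓡 d) x₀).symm) y (e i) *
        fderiv ℝ (v ∘ (extChartAt (𝓡 d) x₀).symm) y (e k) := by
  set x := (extChartAt (𝓡 d) x₀).symm y with hx
  set t : Matrix (Fin d) (Fin d) ℝ := Matrix.of fun a i => chartDiff x₀ y (e i) a with ht
  have hp : ∀ {f : M → ℂ}, MDifferentiableAt (𝓡 d) 𝓘(ℝ, ℂ) f x → ∀ i,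
      fderiv ℝ (f ∘ (extChartAt (𝓡 d) x₀).symm) y (e i) = ∑ a, (t a i : ℂ) * partialAt f x a := by
    intro f hf i
    rw [fderiv_comp_chart_symm hy hf, eq_sum_smul_e (chartDiff x₀ y (e i)), map_sum]
    refine Finset.sum_congr rfl fun a _ => ?_
    rw [map_smul, Complex.real_smul]
    rfl
  -- `t` is the Jacobian from the chart at `x₀` to the chart at `x`
  have hW : chartMatrix Ω x₀ y = tᵀ * Ω.matrix x * t := by
    ext i j
    have h1 : chartMatrix Ω x₀ y i j =
        bilin (formAt Ω x) (chartDiff x₀ y (e i)) (chartDiff x₀ y (e j)) := bilin_inChart _ _ _ _ _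
    rw [h1, bilin_eq_sum, mul_apply, Finset.sum_comm]
    refine Finset.sum_congr rfl fun b _ => ?_
    rw [mul_apply, Finset.sum_mul]
    refine Finset.sum_congr rfl fun a _ => ?_
    rw [transpose_apply, matrix_apply, mul_right_comm]
    rfl
  have hdet := (hΩ.isSymplecticMatrix x₀).det_ne_zero y hy
  have hdt : IsUnit t.det := by
    rw [hW, det_mul, det_mul] at hdet
    exact isUnit_iff_ne_zero.mpr (right_ne_zero_of_mul hdet)
  have hinv : (Ω.matrix x)⁻¹ = t * (chartMatrix Ω x₀ y)⁻¹ * tᵀ := by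
    rw [hW, Matrix.mul_inv_rev, Matrix.mul_inv_rev, ← Matrix.mul_assoc, mul_nonsing_inv _ hdt,
      Matrix.one_mul, Matrix.mul_assoc, nonsing_inv_mul _ (by rwa [det_transpose]), Matrix.mul_one]
  simp only [hp hu, hp hv]
  unfold poisson
  rw [hinv]
  simp only [mul_apply, transpose_apply, Complex.ofReal_sum, Complex.ofReal_mul, Finset.sum_mul,
    Finset.mul_sum]
  rw [sum_comm_four]
  refine Finset.sum_congr rfl fun i _ => Finset.sum_congr rfl fun k _ =>
    Finset.sum_congr rfl fun b _ => Finset.sum_congr rfl fun a _ => ?_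
  ring

end Chart

/-! ### Sums of Poisson brackets in a chart domain -/

section Transfer

variable {d : ℕ} {M : Type*} [TopologicalSpace M] [ChartedSpace (E d) M]

/-- A function read in the chart at `x₀` and extended by zero outside the range of the chart. -/
noncomputable def pushChart (x₀ : M) (f : M → ℂ) (y : E d) : ℂ :=
  open Classical in if y ∈ (extChartAt (𝓡 d) x₀).target then f ((extChartAt (𝓡 d) x₀).symm y) else 0

/-- A function on the model space pulled back by the chart at `x₀` and extended by zero outside the
domain of the chart. -/
noncomputable def pullChart (x₀ : M) (a : E d → ℂ) (x : M) : ℂ :=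
  open Classical in if x ∈ (extChartAt (𝓡 d) x₀).source then a (extChartAt (𝓡 d) x₀ x) else 0

theorem pushChart_apply {x₀ x : M} (f : M → ℂ) (hx : x ∈ (extChartAt (𝓡 d) x₀).source) :
    pushChart x₀ f (extChartAt (𝓡 d) x₀ x) = f x := by
  rw [pushChart, if_pos ((extChartAt (𝓡 d) x₀).map_source hx), (extChartAt (𝓡 d) x₀).left_inv hx]

theorem pullChart_apply_symm {x₀ : M} {y : E d} (a : E d → ℂ)
    (hy : y ∈ (extChartAt (𝓡 d) x₀).target) :
    pullChart x₀ a ((extChartAt (𝓡 d) x₀).symm y) = a y := by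
  rw [pullChart, if_pos ((extChartAt (𝓡 d) x₀).map_target hy), (extChartAt (𝓡 d) x₀).right_inv hy]

theorem contDiff_pushChart [IsManifold (𝓡 d) ∞ M] {x₀ : M} {f : M → ℂ}
    (hf : ContMDiff (𝓡 d) 𝓘(ℝ, ℂ) ∞ f) (hc : HasCompactSupport f)
    (hs : tsupport f ⊆ (extChartAt (𝓡 d) x₀).source) :
    ContDiff ℝ ∞ (pushChart (d := d) x₀ f) := by
  rw [contDiff_iff_contDiffAt]
  intro y
  have hT := isOpen_extChartAt_target (I := 𝓡 d) x₀
  by_cases hy : y ∈ (extChartAt (𝓡 d) x₀).target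
  · have h1 : ContMDiffAt 𝓘(ℝ, E d) 𝓘(ℝ, ℂ) ∞ (f ∘ (extChartAt (𝓡 d) x₀).symm) y :=
      hf.contMDiffAt.comp y ((contMDiffOn_extChartAt_symm x₀).contMDiffAt (hT.mem_nhds hy))
    refine (contMDiffAt_iff_contDiffAt.mp h1).congr_of_eventuallyEq ?_
    filter_upwards [hT.mem_nhds hy] with z hz
    rw [pushChart, if_pos hz]
    rfl
  · have hK : IsCompact (extChartAt (𝓡 d) x₀ '' tsupport f) :=
      IsCompact.image_of_continuousOn hc ((continuousOn_extChartAt x₀).mono hs)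
    refine (contDiffAt_const (c := (0 : ℂ))).congr_of_eventuallyEq ?_
    have hyK : y ∉ extChartAt (𝓡 d) x₀ '' tsupport f := by
      rintro ⟨x, hx, rfl⟩
      exact hy ((extChartAt (𝓡 d) x₀).map_source (hs hx))
    filter_upwards [hK.isClosed.isOpen_compl.mem_nhds hyK] with z hz
    rw [pushChart]
    split_ifs with hzT
    · by_contra h0
      exact hz ⟨_, subset_tsupport f h0, (extChartAt (𝓡 d) x₀).right_inv hzT⟩
    · rfl

theorem pushChart_eq_zero {x₀ : M} {f : M → ℂ} {W : Set (E d)}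
    (hs : tsupport f ⊆ (extChartAt (𝓡 d) x₀) ⁻¹' W) {y : E d} (hy : y ∉ W) :
    pushChart x₀ f y = 0 := by
  rw [pushChart]
  split_ifs with hyT
  · by_contra h0
    have := hs (subset_tsupport f h0)
    rw [Set.mem_preimage, (extChartAt (𝓡 d) x₀).right_inv hyT] at this
    exact hy this
  · rfl

theorem pullChart_support [T2Space M] {x₀ : M} {a : E d → ℂ} {y₀ : E d} {r : ℝ}
    (ha0 : ∀ y ∉ cube y₀ r, a y = 0)
    (hc : {y : E d | ∀ i, |y i - y₀ i| ≤ r} ⊆ (extChartAt (𝓡 d) x₀).target) :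
    HasCompactSupport (pullChart x₀ a) ∧
      tsupport (pullChart x₀ a) ⊆ (extChartAt (𝓡 d) x₀).source := by
  set K := (extChartAt (𝓡 d) x₀).symm '' {y : E d | ∀ i, |y i - y₀ i| ≤ r}
  have hK : IsCompact K :=
    (isCompact_closedCube y₀ r).image_of_continuousOn ((continuousOn_extChartAt_symm x₀).mono hc)
  have h0 : Function.support (pullChart x₀ a) ⊆ K := by
    intro x hx
    rw [Function.mem_support, pullChart] at hx
    split_ifs at hx with hxs
    · refine ⟨_, fun i => ?_, (extChartAt (𝓡 d) x₀).left_inv hxs⟩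
      by_contra hi
      exact hx (ha0 _ fun h => hi (h i).le)
    · exact absurd rfl hx
  have h1 : tsupport (pullChart x₀ a) ⊆ K := closure_minimal h0 hK.isClosed
  refine ⟨hK.of_isClosed_subset (isClosed_tsupport _) h1, h1.trans ?_⟩
  rintro _ ⟨y, hy, rfl⟩
  exact (extChartAt (𝓡 d) x₀).map_target (hc hy)

theorem contMDiff_pullChart [IsManifold (𝓡 d) ∞ M] {x₀ : M} {a : E d → ℂ} (ha : ContDiff ℝ ∞ a)
    (hs : tsupport (pullChart x₀ a) ⊆ (extChartAt (𝓡 d) x₀).source) :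
    ContMDiff (𝓡 d) 𝓘(ℝ, ℂ) ∞ (pullChart x₀ a) := by
  refine contMDiff_of_tsupport fun x hx => ?_
  have hxs := hs hx
  have h1 : ContMDiffAt (𝓡 d) 𝓘(ℝ, ℂ) ∞ (a ∘ extChartAt (𝓡 d) x₀) x :=
    ha.contMDiff.contMDiffAt.comp x (contMDiffAt_extChartAt' (by rwa [extChartAt_source] at hxs))
  refine h1.congr_of_eventuallyEq ?_
  filter_upwards [(isOpen_extChartAt_source x₀).mem_nhds hxs] with z hz
  rw [pullChart, if_pos hz]
  rfl

theorem poisson_eq_zero {Ω : TwoForm d M} {u : M → ℂ} (v : M → ℂ) {x : M} (hx : x ∉ tsupport u) :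
    poisson Ω u v x = 0 := by
  have h : ∀ i, partialAt (d := d) u x i = 0 := by
    intro i
    have h1 : u =ᶠ[𝓝 x] fun _ => 0 := notMem_tsupport_iff_eventuallyEq.mp hx
    have h2 : mfderiv (𝓡 d) 𝓘(ℝ, ℂ) u x = 0 := by
      rw [Filter.EventuallyEq.mfderiv_eq h1]
      exact mfderiv_const
    unfold partialAt
    rw [h2]
    rfl
  simp [poisson, h]

/-- A family of smooth functions whose differentials span all cotangent spaces. -/
structure SpansCotangent {ι : Type*} (b : ι → M → ℝ) : Prop where
  smooth : ∀ j, ContMDiff (𝓡 d) 𝓘(ℝ, ℝ) ∞ (b j)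
  span : ∀ (x : M) (v : E d), (∀ j, diffAt (b j) x v = 0) → v = 0

/-- A real-valued function as a complex-valued one. -/
def toComplex (b : M → ℝ) (x : M) : ℂ := (b x : ℂ)

/-- Near every point, compactly supported functions are multiples of any given nonnegative nonzero
one, modulo brackets with a family whose differentials span. -/
theorem SpansCotangent.exists_local [IsManifold (𝓡 d) ∞ M] [T2Space M] {Ω : TwoForm d M}
    (hΩ : IsSymplectic Ω) {ι : Type*} [Fintype ι]
    {b : ι → M → ℝ} (hb : SpansCotangent (d := d) b) (x₀ : M) :
    ∃ V : Set M, IsOpen V ∧ x₀ ∈ V ∧ ∀ f h : Smooth d M,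
      HasCompactSupport (f : M → ℂ) → tsupport (f : M → ℂ) ⊆ V →
      HasCompactSupport (h : M → ℂ) → tsupport (h : M → ℂ) ⊆ V →
      (∀ x, 0 ≤ ((h : M → ℂ) x).re) → (∃ x, ((h : M → ℂ) x).re ≠ 0) →
      ∃ (c : ℂ) (a : ι → Smooth d M), (∀ j, HasCompactSupport (a j : M → ℂ)) ∧
        ∀ x, (f : M → ℂ) x = c * (h : M → ℂ) x + ∑ j, poisson Ω (a j) (toComplex (b j)) x := by
  set φ := extChartAt (𝓡 d) x₀ with hφ
  obtain ⟨r', hr', hc'⟩ := exists_cube_subset (extChartAt_target_mem_nhds (I := 𝓡 d) x₀)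
  obtain ⟨r, rfl⟩ : ∃ r, r' = 2 * r := ⟨r' / 2, by ring⟩
  have hr : 0 < r := by linarith
  have hcl : {y : E d | ∀ i, |y i - φ x₀ i| ≤ r} ⊆ φ.target := fun y hy =>
    hc' fun i => lt_of_le_of_lt (hy i) (by linarith)
  refine ⟨φ.source ∩ φ ⁻¹' cube (φ x₀) r,
    (continuousOn_extChartAt x₀).isOpen_inter_preimage (isOpen_extChartAt_source x₀)
      (isOpen_cube _ _), ⟨mem_extChartAt_source x₀, mem_cube_self _ hr⟩, ?_⟩
  intro f h hfc hfs hhc hhs hpos hne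
  have hw := hΩ.isSymplecticMatrix x₀
  have hbd : ∀ j x, MDifferentiableAt (𝓡 d) 𝓘(ℝ, ℝ) (b j) x := fun j x =>
    (hb.smooth j).mdifferentiable (by simp) x
  have hB : ∀ j, ContDiffOn ℝ ∞ (b j ∘ φ.symm) φ.target := fun j => by
    have h1 : ContMDiffOn 𝓘(ℝ, E d) 𝓘(ℝ, ℝ) ∞ (b j ∘ φ.symm) φ.target :=
      (hb.smooth j).comp_contMDiffOn (contMDiffOn_extChartAt_symm x₀)
    exact contMDiffOn_iff_contDiffOn.mp h1
  have hspan : ∀ z ∈ φ.target, ∀ v : E d, (∀ j, fderiv ℝ (b j ∘ φ.symm) z v = 0) → v = 0 := by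
    intro z hz v hv
    have h1 := hb.span (φ.symm z) (chartDiff x₀ z v) fun j => by
      rw [← fderiv_comp_chart_symm hz (hbd j _)]
      exact hv j
    exact (chartDiff_bijective hz).1 (h1.trans (map_zero _).symm)
  obtain ⟨c, a, ha, ha0, hfa⟩ := hw.exists_eq_add_bracket (B := fun j => b j ∘ φ.symm) hB hspan hr hc'
    (H := pushChart x₀ h) (contDiff_pushChart h.2 hhc (hhs.trans Set.inter_subset_left))
    (fun y hy => pushChart_eq_zero (hhs.trans Set.inter_subset_right) hy)
    (fun y => by
      rw [pushChart]
      split_ifs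
      · exact hpos _
      · simp)
    (by
      obtain ⟨x, hx⟩ := hne
      have hxs : x ∈ φ.source := (hhs (subset_tsupport _ fun h0 => hx (by rw [h0]; rfl))).1
      exact ⟨φ x, by rwa [pushChart_apply _ hxs]⟩)
    (F := pushChart x₀ f) (contDiff_pushChart f.2 hfc (hfs.trans Set.inter_subset_left))
    (fun y hy => pushChart_eq_zero (hfs.trans Set.inter_subset_right) hy)
  have hsupp := fun j => pullChart_support (x₀ := x₀) (ha0 j) hcl
  refine ⟨c, fun j => ⟨pullChart x₀ (a j), contMDiff_pullChart (ha j) (hsupp j).2⟩,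
    fun j => (hsupp j).1, fun x => ?_⟩
  by_cases hx : x ∈ φ.source
  · have hy := φ.map_source hx
    have h1 := hfa (φ x) hy
    rw [pushChart_apply _ hx, pushChart_apply _ hx] at h1
    rw [h1]
    congr 1
    refine Finset.sum_congr rfl fun j _ => ?_
    have hxx : φ.symm (φ x) = x := φ.left_inv hx
    have hA : MDifferentiableAt (𝓡 d) 𝓘(ℝ, ℂ) (pullChart x₀ (a j)) (φ.symm (φ x)) :=
      (contMDiff_pullChart (ha j) (hsupp j).2).mdifferentiable (by simp) _
    have hbC : MDifferentiableAt (𝓡 d) 𝓘(ℝ, ℂ) (toComplex (b j)) (φ.symm (φ x)) :=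
      (Complex.ofRealCLM.contDiff.contMDiff.comp (hb.smooth j)).mdifferentiable (n := ∞) (by simp) _
    have h2 := poisson_eq_chart hΩ hy hA hbC
    rw [hxx] at h2
    refine Eq.trans ?_ h2.symm
    refine Finset.sum_congr rfl fun i _ => Finset.sum_congr rfl fun k _ => ?_
    congr 1
    · congr 1
      refine congrArg (fun L : E d →L[ℝ] ℂ => L (e i)) (Filter.EventuallyEq.fderiv_eq ?_)
      filter_upwards [hw.isOpen.mem_nhds hy] with z hz
      exact (pullChart_apply_symm (a j) hz).symm
    · have h3 : DifferentiableAt ℝ (b j ∘ φ.symm) (φ x) :=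
        ((hB j).contDiffAt (hw.isOpen.mem_nhds hy)).differentiableAt (by simp)
      have h4 := (Complex.ofRealCLM.hasFDerivAt.comp (φ x) h3.hasFDerivAt).fderiv
      exact (congrArg (fun L : E d →L[ℝ] ℂ => L (e k)) h4).symm
  · have hfx : (f : M → ℂ) x = 0 := image_eq_zero_of_notMem_tsupport fun h => hx (hfs h).1
    have hhx : (h : M → ℂ) x = 0 := image_eq_zero_of_notMem_tsupport fun h => hx (hhs h).1
    rw [hfx, hhx, mul_zero, zero_add]
    refine (Finset.sum_eq_zero fun j _ => ?_).symm
    exact poisson_eq_zero _ fun h => hx ((hsupp j).2 h)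

end Transfer

/-! ### Sums of Poisson brackets on a connected manifold -/

section Global

variable {d : ℕ} {M : Type*} [TopologicalSpace M] [ChartedSpace (E d) M]

theorem smooth_mdifferentiableAt (u : Smooth d M) (x : M) :
    MDifferentiableAt (𝓡 d) 𝓘(ℝ, ℂ) (u : M → ℂ) x :=
  ContMDiff.mdifferentiable (n := ∞) u.2 (by simp) x

theorem poisson_add (Ω : TwoForm d M) (u u' : Smooth d M) (v : M → ℂ) (x : M) :
    poisson Ω (u + u' : Smooth d M) v x = poisson Ω u v x + poisson Ω u' v x := by
  have h : ∀ i, partialAt (d := d) (u + u' : Smooth d M) x i =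
      partialAt (d := d) u x i + partialAt (d := d) u' x i := by
    intro i
    have h1 := mfderiv_add (smooth_mdifferentiableAt u x) (smooth_mdifferentiableAt u' x)
    exact congrArg (fun L : E d →L[ℝ] ℂ => L (e i)) h1
  simp only [poisson, h, ← Finset.sum_add_distrib]
  refine Finset.sum_congr rfl fun i _ => Finset.sum_congr rfl fun j _ => ?_
  ring

theorem poisson_smul (Ω : TwoForm d M) (c : ℂ) (u : Smooth d M) (v : M → ℂ) (x : M) :
    poisson Ω (c • u : Smooth d M) v x = c * poisson Ω u v x := by
  have h : ∀ i, partialAt (d := d) (c • u : Smooth d M) x i = c * partialAt (d := d) u x i := by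
    intro i
    have h1 := ((ContinuousLinearMap.mul ℝ ℂ c).hasMFDerivAt.comp x
      (smooth_mdifferentiableAt u x).hasMFDerivAt).mfderiv
    exact congrArg (fun L : E d →L[ℝ] ℂ => L (e i)) h1
  simp only [poisson, h, Finset.mul_sum]
  refine Finset.sum_congr rfl fun i _ => Finset.sum_congr rfl fun j _ => ?_
  ring

/-- The functions which are sums of Poisson brackets of compactly supported functions with the
members of a fixed finite family. -/
noncomputable def brackets (Ω : TwoForm d M) {ι : Type*} [Fintype ι] (b : ι → M → ℝ) :
    Submodule ℂ (Smooth d M) where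
  carrier := {f | ∃ a : ι → Smooth d M, (∀ j, HasCompactSupport (a j : M → ℂ)) ∧
    ∀ x, (f : M → ℂ) x = ∑ j, poisson Ω (a j) (toComplex (b j)) x}
  add_mem' := by
    rintro f g ⟨a, ha, hf⟩ ⟨a', ha', hg⟩
    refine ⟨fun j => a j + a' j, fun j => (ha j).add (ha' j), fun x => ?_⟩
    simp only [poisson_add, Finset.sum_add_distrib, ← hf, ← hg]
    rfl
  zero_mem' := by
    refine ⟨fun _ => 0, fun _ => HasCompactSupport.zero, fun x => ?_⟩
    refine (Finset.sum_eq_zero fun j _ => poisson_eq_zero _ ?_).symm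
    simp [tsupport]
  smul_mem' := by
    rintro c f ⟨a, ha, hf⟩
    refine ⟨fun j => c • a j, fun j => (ha j).smul_left (f := fun _ => c), fun x => ?_⟩
    simp only [poisson_smul, ← Finset.mul_sum, ← hf]
    rfl

variable [IsManifold (𝓡 d) ∞ M] [T2Space M]

theorem exists_bump {V : Set M} (hV : IsOpen V) {x : M} (hx : x ∈ V) :
    ∃ h : Smooth d M, HasCompactSupport (h : M → ℂ) ∧ tsupport (h : M → ℂ) ⊆ V ∧
      (∀ x, 0 ≤ ((h : M → ℂ) x).re) ∧ ∃ x, ((h : M → ℂ) x).re ≠ 0 := by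
  obtain ⟨f, -, hf⟩ := (SmoothBumpFunction.nhds_basis_tsupport (I := 𝓡 d) x).mem_iff.mp
    (hV.mem_nhds hx)
  have hts : tsupport (fun z => (f z : ℂ)) ⊆ tsupport f := closure_mono fun z hz => by
    intro h0
    exact hz (by simp [h0])
  refine ⟨⟨fun z => (f z : ℂ), Complex.ofRealCLM.contDiff.contMDiff.comp f.contMDiff⟩, ?_,
    hts.trans hf, fun z => ?_, x, ?_⟩
  · exact f.hasCompactSupport.of_isClosed_subset (isClosed_tsupport _) hts
  · simpa using f.nonneg
  · simp

variable [SigmaCompactSpace M] [ConnectedSpace M]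

/-- On a connected symplectic manifold the compactly supported functions form a line modulo Poisson
brackets with a finite family whose differentials span. -/
theorem SpansCotangent.exists_global {Ω : TwoForm d M} (hΩ : IsSymplectic Ω) {ι : Type*} [Fintype ι]
    {b : ι → M → ℝ} (hb : SpansCotangent (d := d) b) :
    ∃ ρ : Smooth d M, HasCompactSupport (ρ : M → ℂ) ∧ ∀ f : Smooth d M,
      HasCompactSupport (f : M → ℂ) → ∃ (c : ℂ) (a : ι → Smooth d M),
        (∀ j, HasCompactSupport (a j : M → ℂ)) ∧
        ∀ x, (f : M → ℂ) x = c * (ρ : M → ℂ) x + ∑ j, poisson Ω (a j) (toComplex (b j)) x := by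
  choose V hVo hxV hV using hb.exists_local hΩ
  -- the local statement, modulo brackets
  have hV' : ∀ x₀ (f h : Smooth d M),
      HasCompactSupport (f : M → ℂ) → tsupport (f : M → ℂ) ⊆ V x₀ →
      HasCompactSupport (h : M → ℂ) → tsupport (h : M → ℂ) ⊆ V x₀ →
      (∀ x, 0 ≤ ((h : M → ℂ) x).re) → (∃ x, ((h : M → ℂ) x).re ≠ 0) →
      ∃ c : ℂ, f - c • h ∈ brackets Ω b := by
    intro x₀ f h h1 h2 h3 h4 h5 h6
    obtain ⟨c, a, ha, hfa⟩ := hV x₀ f h h1 h2 h3 h4 h5 h6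
    refine ⟨c, a, ha, fun x => ?_⟩
    change (f : M → ℂ) x - c * (h : M → ℂ) x = _
    rw [hfa x]
    ring
  obtain ⟨x₁⟩ := ‹ConnectedSpace M›.toNonempty
  obtain ⟨ρ, hρc, hρV, hρ0, hρ1⟩ := exists_bump (d := d) (hVo x₁) (hxV x₁)
  let Q : Submodule ℂ (Smooth d M) := Submodule.span ℂ {ρ} ⊔ brackets Ω b
  have hQ : ∀ f : Smooth d M, f ∈ Q ↔ ∃ c : ℂ, f - c • ρ ∈ brackets Ω b := by
    intro f
    constructor
    · intro hf
      obtain ⟨g, hg, k, hk, rfl⟩ := Submodule.mem_sup.mp hf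
      obtain ⟨c, rfl⟩ := Submodule.mem_span_singleton.mp hg
      exact ⟨c, by simpa using hk⟩
    · rintro ⟨c, hc⟩
      have : f = c • ρ + (f - c • ρ) := by abel
      rw [this]
      exact Submodule.add_mem_sup (Submodule.mem_span_singleton.mpr ⟨c, rfl⟩) hc
  -- the set of points near which functions are multiples of `ρ` modulo brackets is open and closed
  let A : Set M := {x | ∃ U : Set M, IsOpen U ∧ x ∈ U ∧ ∀ f : Smooth d M,
    HasCompactSupport (f : M → ℂ) → tsupport (f : M → ℂ) ⊆ U → f ∈ Q}
  have hAo : IsOpen A := by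
    rw [isOpen_iff_mem_nhds]
    rintro x ⟨U, hU, hxU, h⟩
    filter_upwards [hU.mem_nhds hxU] with z hz
    exact ⟨U, hU, hz, h⟩
  have hAc : IsClosed A := by
    refine isClosed_of_closure_subset fun x hx => ?_
    obtain ⟨x', hx'V, U, hU, hx'U, hUQ⟩ := mem_closure_iff.mp hx (V x) (hVo x) (hxV x)
    obtain ⟨h, hc, hs, h0, h1⟩ := exists_bump (d := d) ((hVo x).inter hU) ⟨hx'V, hx'U⟩
    refine ⟨V x, hVo x, hxV x, fun f hfc hfs => ?_⟩
    obtain ⟨c, hcf⟩ := hV' x f h hfc hfs hc (hs.trans Set.inter_subset_left) h0 h1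
    have hhQ := hUQ h hc (hs.trans Set.inter_subset_right)
    have : f = c • h + (f - c • h) := by abel
    rw [this]
    exact Q.add_mem (Q.smul_mem c hhQ) (Submodule.mem_sup_right hcf)
  have hAu : A = Set.univ := IsClopen.eq_univ ⟨hAc, hAo⟩ ⟨x₁, V x₁, hVo x₁, hxV x₁,
    fun f hfc hfs => (hQ f).mpr (hV' x₁ f ρ hfc hfs hρc hρV hρ0 hρ1)⟩
  have hA : ∀ x, x ∈ A := fun x => hAu ▸ Set.mem_univ x
  choose U hUo hxU hUQ using hA
  refine ⟨ρ, hρc, fun f hf => ?_⟩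
  obtain ⟨t, ht⟩ := hf.elim_finite_subcover U hUo fun x _ => Set.mem_iUnion.mpr ⟨x, hxU x⟩
  obtain ⟨χ, hχ⟩ := SmoothPartitionOfUnity.exists_isSubordinate (𝓡 d)
    (isClosed_tsupport (f : M → ℂ)) (fun i : t => U i) (fun i => hUo i) (by
      intro x hx
      obtain ⟨i, hi, hxi⟩ := Set.mem_iUnion₂.mp (ht hx)
      exact Set.mem_iUnion.mpr ⟨⟨i, hi⟩, hxi⟩)
  let g : t → Smooth d M := fun i =>
    ⟨fun x => (χ i x : ℂ), Complex.ofRealCLM.contDiff.contMDiff.comp (χ i).contMDiff⟩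
  have hfg : f = ∑ i, g i * f := by
    rw [← Finset.sum_mul]
    apply Subtype.ext
    ext x
    by_cases hx : x ∈ tsupport (f : M → ℂ)
    · have h1 := χ.sum_eq_one hx
      rw [finsum_eq_sum_of_fintype] at h1
      have h2 : ((∑ i, g i : Smooth d M) : M → ℂ) x = ∑ i, (χ i x : ℂ) := by
        rw [AddSubmonoidClass.coe_finsetSum, Finset.sum_apply]
      change _ = ((∑ i, g i : Smooth d M) : M → ℂ) x * (f : M → ℂ) x
      rw [h2, ← Complex.ofReal_sum, h1, Complex.ofReal_one, one_mul]
    · have h0 := image_eq_zero_of_notMem_tsupport hx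
      change _ = ((∑ i, g i : Smooth d M) : M → ℂ) x * (f : M → ℂ) x
      rw [h0, mul_zero]
  have hfQ : f ∈ Q := by
    rw [hfg]
    refine Q.sum_mem fun i _ => hUQ i _ (hf.mul_left (f := (g i : M → ℂ))) ?_
    refine Set.Subset.trans ?_ (hχ i)
    refine closure_mono fun x hx h0 => hx ?_
    change (χ i x : ℂ) * (f : M → ℂ) x = 0
    rw [h0]; simp
  obtain ⟨c, a, ha, hfa⟩ := (hQ f).mp hfQ
  refine ⟨c, a, ha, fun x => ?_⟩
  rw [← hfa x]
  change _ = c * (ρ : M → ℂ) x + ((f : M → ℂ) x - c * (ρ : M → ℂ) x)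
  ring

end Global

/-! ### Partitions of unity on annuli -/

section Annuli

variable {d : ℕ} {M : Type*} [TopologicalSpace M] [ChartedSpace (E d) M]

/-- A smooth partition of unity `χ` by functions living on successive annuli of an exhaustion,
together with cutoffs `θ k` equal to `1` near the support of `χ k`; cutoffs whose indices differ by
at least four have disjoint supports. -/
structure Annuli (d : ℕ) (M : Type*) [TopologicalSpace M] [ChartedSpace (E d) M] where
  /-- The partition of unity. -/
  χ : ℕ → M → ℝ
  /-- The cutoffs. -/
  θ : ℕ → M → ℝ
  smooth_χ : ∀ k, ContMDiff (𝓡 d) 𝓘(ℝ, ℝ) ∞ (χ k)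
  smooth_θ : ∀ k, ContMDiff (𝓡 d) 𝓘(ℝ, ℝ) ∞ (θ k)
  compact_θ : ∀ k, HasCompactSupport (θ k)
  θ_eq_one : ∀ k, ∀ x ∈ tsupport (χ k), θ k =ᶠ[𝓝 x] 1
  disjoint_θ : ∀ k l, k + 4 ≤ l → Disjoint (tsupport (θ k)) (tsupport (θ l))
  eventually_disjoint : ∀ K : Set M, IsCompact K → ∃ m, ∀ k ≥ m, Disjoint (tsupport (θ k)) K
  sum_χ : ∀ x : M, ∃ m, ∀ m' ≥ m, ∑ k ∈ Finset.range m', χ k x = 1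

theorem Annuli.nonempty (d : ℕ) (M : Type*) [TopologicalSpace M] [ChartedSpace (E d) M]
    [IsManifold (𝓡 d) ∞ M] [T2Space M] [SigmaCompactSpace M] : Nonempty (Annuli d M) := by
  have : LocallyCompactSpace M := ChartedSpace.locallyCompactSpace (E d) M
  -- with `η n` a cutoff which is `1` near `L n` and supported in `L (n + 1)`, `χ k` and `θ k` are
  -- `η (k + 3) - η (k + 2)` and `η (k + 4) - η (k + 1)`; the first sets `L n` are empty so that the
  -- sum of all `χ k` is `1`
  let K : CompactExhaustion M := CompactExhaustion.choice M
  let L : ℕ → Set M := fun n => if n < 4 then ∅ else K n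
  have hLc : ∀ n, IsCompact (L n) := fun n => by
    simp only [L]; split_ifs
    · exact isCompact_empty
    · exact K.isCompact n
  have hLi : ∀ n, L n ⊆ interior (L (n + 1)) := fun n => by
    simp only [L]
    by_cases h : n < 4
    · rw [if_pos h]; exact Set.empty_subset _
    · rw [if_neg h, if_neg (by omega)]
      exact K.subset_interior_succ n
  have hLm : Monotone L := monotone_nat_of_le_succ fun n => (hLi n).trans interior_subset
  have hex : ∀ S : Set M, IsCompact S → ∃ n, S ⊆ L n := fun S hS => by
    obtain ⟨n, hn⟩ := K.exists_superset_of_isCompact hS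
    refine ⟨n + 4, hn.trans ?_⟩
    simp only [L]
    rw [if_neg (by omega)]
    exact K.subset (by omega)
  have hη : ∀ n, ∃ η : M → ℝ, ContMDiff (𝓡 d) 𝓘(ℝ, ℝ) ∞ η ∧ (∀ x ∈ L n, η =ᶠ[𝓝 x] 1) ∧
      tsupport η ⊆ L (n + 1) := fun n => by
    obtain ⟨f, hf1, hf0, -⟩ := exists_contMDiffMap_one_nhds_of_subset_interior (𝓡 d)
      (n := (⊤ : ℕ∞)) (hLc n).isClosed (hLi n)
    refine ⟨f, f.contMDiff, fun x hx => ?_, ?_⟩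
    · exact Filter.Eventually.filter_mono (nhds_le_nhdsSet hx) hf1
    · refine closure_minimal (fun x hx => ?_) (hLc _).isClosed
      by_contra h
      exact hx (hf0 x h)
  choose η hηs hη1 hηt using hη
  have hη0 : ∀ n, ∀ x ∉ L (n + 1), η n =ᶠ[𝓝 x] 0 := fun n x hx =>
    notMem_tsupport_iff_eventuallyEq.mp fun h => hx (hηt n h)
  have hχt : ∀ k, tsupport (fun x => η (k + 3) x - η (k + 2) x) ⊆ L (k + 4) \ L (k + 2) := by
    intro k x hx
    refine ⟨?_, ?_⟩
    · by_contra h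
      refine absurd hx (notMem_tsupport_iff_eventuallyEq.mpr ?_)
      filter_upwards [hη0 (k + 3) x h, hη0 (k + 2) x fun h' => h (hLm (by omega) h')] with z h1 h2
      rw [h1, h2]; simp
    · intro h
      refine absurd hx (notMem_tsupport_iff_eventuallyEq.mpr ?_)
      filter_upwards [hη1 (k + 2) x h, hη1 (k + 3) x (hLm (by omega) h)] with z h1 h2
      rw [h1, h2]; simp
  have hθt : ∀ k, tsupport (fun x => η (k + 4) x - η (k + 1) x) ⊆ L (k + 5) \ L (k + 1) := by
    intro k x hx
    refine ⟨?_, ?_⟩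
    · by_contra h
      refine absurd hx (notMem_tsupport_iff_eventuallyEq.mpr ?_)
      filter_upwards [hη0 (k + 4) x h, hη0 (k + 1) x fun h' => h (hLm (by omega) h')] with z h1 h2
      rw [h1, h2]; simp
    · intro h
      refine absurd hx (notMem_tsupport_iff_eventuallyEq.mpr ?_)
      filter_upwards [hη1 (k + 1) x h, hη1 (k + 4) x (hLm (by omega) h)] with z h1 h2
      rw [h1, h2]; simp
  refine ⟨⟨fun k x => η (k + 3) x - η (k + 2) x, fun k x => η (k + 4) x - η (k + 1) x,
    fun k => (hηs _).sub (hηs _), fun k => (hηs _).sub (hηs _), fun k => ?_, fun k x hx => ?_,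
    fun k l hkl => ?_, fun S hS => ?_, fun x => ?_⟩⟩
  · exact (hLc (k + 5)).of_isClosed_subset (isClosed_tsupport _)
      ((hθt k).trans Set.sdiff_subset)
  · have h := hχt k hx
    filter_upwards [hη1 (k + 4) x h.1, hη0 (k + 1) x h.2] with z h1 h2
    rw [h1, h2]; simp
  · rw [Set.disjoint_left]
    intro x hx hx'
    exact (hθt l hx').2 (hLm (by omega) (hθt k hx).1)
  · obtain ⟨m, hm⟩ := hex S hS
    refine ⟨m, fun k hk => Set.disjoint_left.mpr fun x hx hxS => ?_⟩
    exact (hθt k hx).2 (hLm (by omega) (hm hxS))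
  · obtain ⟨m, hm⟩ := hex {x} isCompact_singleton
    refine ⟨m, fun m' hm' => ?_⟩
    have h1 := Finset.sum_range_sub (fun k => η (k + 2) x) m'
    rw [h1]
    have h2 : η (m' + 2) x = 1 := (hη1 (m' + 2) x (hLm (by omega) (hm rfl))).self_of_nhds
    have h3 : η (0 + 2) x = 0 := (hη0 (0 + 2) x (by simp [L])).self_of_nhds
    rw [h2, h3, sub_zero]

end Annuli

/-! ### Finite families of functions whose differentials span -/

section Whitney

variable {d : ℕ} {M : Type*} [TopologicalSpace M] [ChartedSpace (E d) M]

theorem diffAt_clm_comp {F F' : Type*} [NormedAddCommGroup F] [NormedSpace ℝ F]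
    [NormedAddCommGroup F'] [NormedSpace ℝ F'] (L : F →L[ℝ] F') {f : M → F} {x : M}
    (hf : MDifferentiableAt (𝓡 d) 𝓘(ℝ, F) f x) (v : E d) :
    diffAt (fun z => L (f z)) x v = L (diffAt f x v) := by
  have h1 := (L.hasMFDerivAt.comp x hf.hasMFDerivAt).mfderiv
  exact congrArg (fun A : E d →L[ℝ] F' => A v) h1

theorem diffAt_congr {F : Type*} [NormedAddCommGroup F] [NormedSpace ℝ F] {f g : M → F} {x : M}
    (h : f =ᶠ[𝓝 x] g) : diffAt (d := d) f x = diffAt g x := by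
  unfold diffAt
  exact h.mfderiv_eq

variable [IsManifold (𝓡 d) ∞ M]

/-- On a compact set, finitely many functions suffice to span the cotangent spaces. -/
theorem exists_immersion_on_compact [T2Space M] {K : Set M} (hK : IsCompact K) :
    ∃ (N : ℕ) (f : M → E N), ContMDiff (𝓡 d) 𝓘(ℝ, E N) ∞ f ∧
      ∀ x ∈ K, ∀ v : E d, diffAt f x v = 0 → v = 0 := by
  -- a chart, cut off by a bump function, is an immersion near its centre
  choose bump _ using fun x : M =>
    (SmoothBumpFunction.nhds_basis_tsupport (I := 𝓡 d) x).mem_iff.mp Filter.univ_mem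
  let g : M → M → E d := fun c x => bump c x • extChartAt (𝓡 d) c x
  have hg : ∀ c, ContMDiff (𝓡 d) 𝓘(ℝ, E d) ∞ (g c) := fun c =>
    (bump c).contMDiff_smul contMDiffOn_extChartAt
  let U : M → Set M := fun c => (chartAt (E d) c).source ∩ interior {x : M | bump c x = 1}
  have hU : ∀ c, IsOpen (U c) := fun c => (chartAt (E d) c).open_source.inter isOpen_interior
  have hcU : ∀ c, c ∈ U c := fun c =>
    ⟨mem_chart_source _ c, mem_interior_iff_mem_nhds.mpr (bump c).eventuallyEq_one⟩
  have hgU : ∀ c, ∀ x ∈ U c, ∀ v : E d, diffAt (g c) x v = 0 → v = 0 := by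
    intro c x hx v hv
    have h1 : g c =ᶠ[𝓝 x] extChartAt (𝓡 d) c := by
      filter_upwards [isOpen_interior.mem_nhds hx.2] with z hz
      have : z ∈ {x : M | bump c x = 1} := interior_subset hz
      rw [Set.mem_ofPred_eq] at this
      simp only [g, this, one_smul]
    rw [diffAt_congr h1] at hv
    have h2 := (isInvertible_mfderiv_extChartAt (I := 𝓡 d) (x := c) (y := x)
      (by rw [extChartAt_source]; exact hx.1)).bijective
    exact h2.1 (hv.trans (map_zero _).symm)
  obtain ⟨t, ht⟩ := hK.elim_finite_subcover U hU fun x _ => Set.mem_iUnion.mpr ⟨x, hcU x⟩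
  let F : M → (t → E d) := fun x i => g i x
  have hF : ContMDiff (𝓡 d) 𝓘(ℝ, t → E d) ∞ F := contMDiff_pi_space.mpr fun i => hg i
  let L : (t → E d) ≃L[ℝ] E (Module.finrank ℝ (t → E d)) :=
    ContinuousLinearEquiv.ofFinrankEq finrank_euclideanSpace_fin.symm
  refine ⟨_, fun x => L (F x), L.contDiff.contMDiff.comp hF, fun x hx v hv => ?_⟩
  have hFd : MDifferentiableAt (𝓡 d) 𝓘(ℝ, t → E d) F x := hF.mdifferentiable (by simp) x
  obtain ⟨c, hc, hxc⟩ := Set.mem_iUnion₂.mp (ht hx)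
  refine hgU c x hxc v ?_
  have h3 : L (diffAt F x v) = 0 := by
    rw [← hv]
    exact (diffAt_clm_comp L.toContinuousLinearMap hFd v).symm
  have h4 : diffAt F x v = 0 := L.injective (h3.trans (map_zero L).symm)
  have h5 := diffAt_clm_comp (ContinuousLinearMap.proj (R := ℝ) (φ := fun _ : t => E d) ⟨c, hc⟩)
    hFd v
  rw [h4, map_zero] at h5
  exact h5

/-- The set of values of the differential of a smooth map has Hausdorff dimension at most `2d`,
being covered by countably many locally Lipschitz images of open subsets of `ℝ^d × ℝ^d`. -/
theorem dimH_range_diffAt [SecondCountableTopology M] {N : ℕ} {f : M → E N}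
    (hf : ContMDiff (𝓡 d) 𝓘(ℝ, E N) ∞ f) :
    dimH {w : E N | ∃ (x : M) (v : E d), diffAt f x v = w} ≤ (2 * d : ℕ) := by
  obtain ⟨s, hs, hsU⟩ := TopologicalSpace.countable_cover_nhds fun c : M =>
    (extChartAt_source_mem_nhds (I := 𝓡 d) c)
  let S : M → Set (E N) := fun c =>
    (fun p : E d × E d => fderiv ℝ (f ∘ (extChartAt (𝓡 d) c).symm) p.1 p.2) ''
      ((extChartAt (𝓡 d) c).target ×ˢ Set.univ)
  have hsub : {w : E N | ∃ (x : M) (v : E d), diffAt f x v = w} ⊆ ⋃ c ∈ s, S c := by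
    rintro _ ⟨x, v, rfl⟩
    have hx : x ∈ ⋃ c ∈ s, (extChartAt (𝓡 d) c).source := hsU ▸ Set.mem_univ x
    obtain ⟨c, hc, hxc⟩ := Set.mem_iUnion₂.mp hx
    refine Set.mem_iUnion₂.mpr ⟨c, hc, ?_⟩
    have hy := (extChartAt (𝓡 d) c).map_source hxc
    obtain ⟨v', rfl⟩ := (chartDiff_bijective hy).2 v
    refine ⟨(extChartAt (𝓡 d) c x, v'), ⟨hy, Set.mem_univ _⟩, ?_⟩
    have h1 := fderiv_comp_chart_symm hy (hf.mdifferentiable (by simp) _) v'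
    rw [(extChartAt (𝓡 d) c).left_inv hxc] at h1
    exact h1
  refine (dimH_mono hsub).trans ?_
  rw [dimH_bUnion hs]
  refine iSup₂_le fun c _ => ?_
  have hT := isOpen_extChartAt_target (I := 𝓡 d) c
  have hfc : ContDiffOn ℝ ∞ (f ∘ (extChartAt (𝓡 d) c).symm) (extChartAt (𝓡 d) c).target :=
    contMDiffOn_iff_contDiffOn.mp (hf.comp_contMDiffOn (contMDiffOn_extChartAt_symm c))
  refine (dimH_image_le_of_locally_lipschitzOn fun p hp => ?_).trans ?_
  · have h1 : ContDiffAt ℝ ∞ (fderiv ℝ (f ∘ (extChartAt (𝓡 d) c).symm)) p.1 :=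
      (hfc.contDiffAt (hT.mem_nhds hp.1)).fderiv_right (m := ∞) (by simp)
    have h2 : ContDiffAt ℝ 1 (fun p : E d × E d =>
        fderiv ℝ (f ∘ (extChartAt (𝓡 d) c).symm) p.1 p.2) p :=
      ((h1.comp p contDiffAt_fst).clm_apply contDiffAt_snd).of_le (by simp)
    obtain ⟨C, u, hu, hL⟩ := h2.exists_lipschitzOnWith
    exact ⟨C, u, mem_nhdsWithin_of_mem_nhds hu, hL⟩
  · refine (dimH_mono (Set.subset_univ _)).trans ?_
    rw [Real.dimH_univ_eq_finrank, Module.finrank_prod, finrank_euclideanSpace_fin, two_mul]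

/-- One projection step in Whitney's argument: as long as there are more than `2d` functions, a
direction missed by the differential may be projected away. -/
theorem exists_immersion_pred [SecondCountableTopology M] [Nonempty M] {K : Set M} {N : ℕ}
    (hN : 2 * d < N + 1) {f : M → E (N + 1)} (hf : ContMDiff (𝓡 d) 𝓘(ℝ, E (N + 1)) ∞ f)
    (hK : ∀ x ∈ K, ∀ v : E d, diffAt f x v = 0 → v = 0) :
    ∃ f' : M → E N, ContMDiff (𝓡 d) 𝓘(ℝ, E N) ∞ f' ∧
      ∀ x ∈ K, ∀ v : E d, diffAt f' x v = 0 → v = 0 := by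
  have hd : Dense {w : E (N + 1) | ∃ (x : M) (v : E d), diffAt f x v = w}ᶜ := by
    refine dense_compl_of_dimH_lt_finrank ((dimH_range_diffAt hf).trans_lt ?_)
    rw [finrank_euclideanSpace_fin]
    exact_mod_cast hN
  obtain ⟨w, hw⟩ := hd.nonempty
  have hw0 : w ≠ 0 := by
    rintro rfl
    exact hw ⟨Classical.arbitrary M, 0, map_zero _⟩
  have hfin : Module.finrank ℝ (E (N + 1) ⧸ Submodule.span ℝ {w}) = Module.finrank ℝ (E N) := by
    have h1 := Submodule.finrank_quotient_add_finrank (Submodule.span ℝ {w})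
    rw [finrank_span_singleton hw0, finrank_euclideanSpace_fin] at h1
    rw [finrank_euclideanSpace_fin]
    omega
  let P : E (N + 1) →L[ℝ] E N := LinearMap.toContinuousLinearMap
    ((LinearEquiv.ofFinrankEq _ _ hfin).toLinearMap ∘ₗ (Submodule.span ℝ {w}).mkQ)
  have hP : ∀ u, P u = 0 → u ∈ Submodule.span ℝ {w} := by
    intro u hu
    have h1 : (LinearEquiv.ofFinrankEq _ _ hfin) ((Submodule.span ℝ {w}).mkQ u) = 0 := hu
    rw [LinearEquiv.map_eq_zero_iff] at h1
    exact (Submodule.Quotient.mk_eq_zero _).mp h1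
  refine ⟨fun x => P (f x), P.contDiff.contMDiff.comp hf, fun x hx v hv => ?_⟩
  rw [diffAt_clm_comp P (hf.mdifferentiable (by simp) x)] at hv
  obtain ⟨c, hc⟩ := Submodule.mem_span_singleton.mp (hP _ hv)
  refine hK x hx v ?_
  by_cases hc0 : c = 0
  · rw [← hc, hc0, zero_smul]
  · exfalso
    refine hw ⟨x, c⁻¹ • v, ?_⟩
    rw [map_smul, ← hc, smul_smul, inv_mul_cancel₀ hc0, one_smul]

/-- The number `2d` of functions is independent of the compact set; if fewer suffice, the family is
filled up with zeros. -/
theorem exists_spanning_on_compact [SecondCountableTopology M] [Nonempty M] [T2Space M] {K : Set M}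
    (hK : IsCompact K) :
    ∃ f : Fin (2 * d) → M → ℝ, (∀ j, ContMDiff (𝓡 d) 𝓘(ℝ, ℝ) ∞ (f j)) ∧
      ∀ x ∈ K, ∀ v : E d, (∀ j, diffAt (f j) x v = 0) → v = 0 := by
  have hred : ∀ N : ℕ, (∃ f : M → E N, ContMDiff (𝓡 d) 𝓘(ℝ, E N) ∞ f ∧
      ∀ x ∈ K, ∀ v : E d, diffAt f x v = 0 → v = 0) → ∃ N' ≤ 2 * d, ∃ f : M → E N',
      ContMDiff (𝓡 d) 𝓘(ℝ, E N') ∞ f ∧ ∀ x ∈ K, ∀ v : E d, diffAt f x v = 0 → v = 0 := by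
    intro N
    induction N with
    | zero => exact fun h => ⟨0, Nat.zero_le _, h⟩
    | succ N ih =>
      rintro ⟨f, hf, hfK⟩
      by_cases hN : N + 1 ≤ 2 * d
      · exact ⟨N + 1, hN, f, hf, hfK⟩
      · exact ih (exists_immersion_pred (by omega) hf hfK)
  obtain ⟨N, f, hf, hfK⟩ := exists_immersion_on_compact (d := d) hK
  obtain ⟨N', hN', f, hf, hfK⟩ := hred N ⟨f, hf, hfK⟩
  refine ⟨fun j x => if h : j.1 < N' then f x ⟨j.1, h⟩ else 0, fun j => ?_, fun x hx v hv => ?_⟩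
  · by_cases h : j.1 < N'
    · simp only [h, dif_pos]
      exact (EuclideanSpace.proj (𝕜 := ℝ) (⟨j.1, h⟩ : Fin N')).contDiff.contMDiff.comp hf
    · simp only [h, dif_neg, not_false_iff]
      exact contMDiff_const
  · refine hfK x hx v ?_
    ext i
    have h1 := hv ⟨i.1, i.2.trans_le hN'⟩
    simp only [i.2, dif_pos] at h1
    have h2 := diffAt_clm_comp (EuclideanSpace.proj (𝕜 := ℝ) i) (hf.mdifferentiable (by simp) x) v
    exact h2.symm.trans h1

/-- On every manifold there are finitely many smooth functions whose differentials span all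
cotangent spaces. The first index is the colour of an annulus: annuli with indices congruent modulo `4` have
disjoint neighbourhoods, and the functions for these annuli are added up. -/
theorem exists_spansCotangent [SecondCountableTopology M] [Nonempty M] [T2Space M]
    [SigmaCompactSpace M] :
    ∃ b : Fin 4 × Fin (2 * d) → M → ℝ, SpansCotangent (d := d) b := by
  obtain ⟨A⟩ := Annuli.nonempty d M
  have hcomp : ∀ k, IsCompact (tsupport (A.χ k)) := fun k =>
    (A.compact_θ k).of_isClosed_subset (isClosed_tsupport _) fun x hx =>
      subset_tsupport _ (by rw [Function.mem_support, (A.θ_eq_one k x hx).self_of_nhds]; simp)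
  choose f hf hfs using fun k => exists_spanning_on_compact (d := d) (hcomp k)
  let b : Fin 4 × Fin (2 * d) → M → ℝ := fun p x =>
    ∑ᶠ k, if k % 4 = p.1.1 then A.θ k x * f k p.2 x else 0
  refine ⟨b, fun p => ?_, fun x v hv => ?_⟩
  · refine contMDiff_finsum (fun k => ?_) fun x => ?_
    · split_ifs
      · exact (A.smooth_θ k).mul (hf k p.2)
      · exact contMDiff_const
    · have : LocallyCompactSpace M := ChartedSpace.locallyCompactSpace (E d) M
      obtain ⟨K, hK, hxK⟩ := exists_compact_mem_nhds x
      obtain ⟨m, hm⟩ := A.eventually_disjoint K hK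
      refine ⟨K, hxK, (Set.finite_lt_nat m).subset ?_⟩
      rintro k ⟨z, hz, hzK⟩
      by_contra hk
      have h1 := Set.disjoint_right.mp (hm k (not_lt.mp hk)) hzK
      apply hz
      simp only [image_eq_zero_of_notMem_tsupport h1, zero_mul, ite_self]
  · obtain ⟨m, hm⟩ := A.sum_χ x
    obtain ⟨k, hk⟩ : ∃ k, A.χ k x ≠ 0 := by
      by_contra! h
      have := hm m le_rfl
      simp [h] at this
    have hxk : x ∈ tsupport (A.χ k) := subset_tsupport _ hk
    refine hfs k x hxk v fun j => ?_
    rw [← hv (⟨k % 4, Nat.mod_lt _ (by norm_num)⟩, j)]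
    refine congrArg (fun L : E d →L[ℝ] ℝ => L v) (diffAt_congr ?_)
    filter_upwards [A.θ_eq_one k x hxk] with z hz
    have hzk : z ∈ tsupport (A.θ k) := subset_tsupport _ (by
      rw [Function.mem_support, hz]; simp)
    simp only [b]
    rw [finsum_eq_single _ k]
    · rw [if_pos rfl, hz, Pi.one_apply, one_mul]
    · intro l hl
      by_cases hlk : l % 4 = k % 4
      · rw [if_pos hlk]
        have : z ∉ tsupport (A.θ l) := by
          rcases lt_or_gt_of_ne hl with h | h
          · exact Set.disjoint_right.mp (A.disjoint_θ l k (by omega)) hzk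
          · exact Set.disjoint_left.mp (A.disjoint_θ k l (by omega)) hzk
        rw [image_eq_zero_of_notMem_tsupport this, zero_mul]
      · rw [if_neg hlk]

end Whitney

/-! ### Locality and linearity of star products -/

section StarAlgebra

open PowerSeries Finset

variable {d : ℕ} {M : Type*} [TopologicalSpace M] [ChartedSpace (E d) M]

theorem smooth_sum_apply {ι : Type*} (s : Finset ι) (f : ι → Smooth d M) (x : M) :
    ((∑ i ∈ s, f i : Smooth d M) : M → ℂ) x = ∑ i ∈ s, (f i : M → ℂ) x := by
  rw [AddSubmonoidClass.coe_finsetSum, Finset.sum_apply]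

theorem IsBidifferential.apply_eq_zero_left {B : Smooth d M →ₗ[ℂ] Smooth d M →ₗ[ℂ] Smooth d M}
    (hB : IsBidifferential B) {u v : Smooth d M} {x : M} (hx : x ∉ tsupport (u : M → ℂ)) :
    (B u v : M → ℂ) x = 0 := by
  obtain ⟨U, -, hxU, hU, m, a, -, h⟩ := hB x
  rw [h u v x hxU]
  refine Finset.sum_eq_zero fun k _ => Finset.sum_eq_zero fun l _ =>
    Finset.sum_eq_zero fun J _ => Finset.sum_eq_zero fun K _ => ?_
  rw [chartDeriv_eq_zero J (hU hxU) hx]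
  simp

theorem IsBidifferential.apply_eq_zero_right {B : Smooth d M →ₗ[ℂ] Smooth d M →ₗ[ℂ] Smooth d M}
    (hB : IsBidifferential B) {u v : Smooth d M} {x : M} (hx : x ∉ tsupport (v : M → ℂ)) :
    (B u v : M → ℂ) x = 0 := by
  obtain ⟨U, -, hxU, hU, m, a, -, h⟩ := hB x
  rw [h u v x hxU]
  refine Finset.sum_eq_zero fun k _ => Finset.sum_eq_zero fun l _ =>
    Finset.sum_eq_zero fun J _ => Finset.sum_eq_zero fun K _ => ?_
  rw [chartDeriv_eq_zero K (hU hxU) hx]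
  simp

theorem IsBidifferential.hasCompactSupport_right
    {B : Smooth d M →ₗ[ℂ] Smooth d M →ₗ[ℂ] Smooth d M} (hB : IsBidifferential B)
    {u v : Smooth d M} (hv : HasCompactSupport (v : M → ℂ)) :
    HasCompactSupport (B u v : M → ℂ) :=
  hv.mono' fun x hx => by
    by_contra h
    exact hx (hB.apply_eq_zero_right h)

/-- Bidifferential operators are local. -/
theorem IsBidifferential.congr {B : Smooth d M →ₗ[ℂ] Smooth d M →ₗ[ℂ] Smooth d M}
    (hB : IsBidifferential B) {u u' v v' : Smooth d M} {x : M}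
    (hu : (u : M → ℂ) =ᶠ[𝓝 x] u') (hv : (v : M → ℂ) =ᶠ[𝓝 x] v') :
    (B u v : M → ℂ) x = (B u' v' : M → ℂ) x := by
  have h1 : B u v = B u' v' + (B (u - u') v + B u' (v - v')) := by
    simp only [map_sub, LinearMap.sub_apply]
    abel
  have h2 : (B (u - u') v : M → ℂ) x = 0 := hB.apply_eq_zero_left (by
    rw [notMem_tsupport_iff_eventuallyEq]
    filter_upwards [hu] with z hz
    change (u : M → ℂ) z - (u' : M → ℂ) z = 0
    rw [hz, sub_self])
  have h3 : (B u' (v - v') : M → ℂ) x = 0 := hB.apply_eq_zero_right (by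
    rw [notMem_tsupport_iff_eventuallyEq]
    filter_upwards [hv] with z hz
    change (v : M → ℂ) z - (v' : M → ℂ) z = 0
    rw [hz, sub_self])
  rw [h1]
  change (B u' v' : M → ℂ) x + ((B (u - u') v : M → ℂ) x + (B u' (v - v') : M → ℂ) x) = _
  rw [h2, h3]
  simp

variable (C : ℕ → Smooth d M →ₗ[ℂ] Smooth d M →ₗ[ℂ] Smooth d M)

theorem coeff_starMul (u v : PowerSeries (Smooth d M)) (n : ℕ) :
    coeff n (starMul C u v) = ∑ p ∈ antidiagonal n, ∑ q ∈ antidiagonal p.2,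
      C p.1 (coeff q.1 u) (coeff q.2 v) := by
  rw [starMul, coeff_mk]

theorem starMul_congr (hC : ∀ r, IsBidifferential (C r)) {u u' v v' : PowerSeries (Smooth d M)}
    {x : M} (hu : ∀ i, ((coeff i u : Smooth d M) : M → ℂ) =ᶠ[𝓝 x] (coeff i u' : Smooth d M))
    (hv : ∀ i, ((coeff i v : Smooth d M) : M → ℂ) =ᶠ[𝓝 x] (coeff i v' : Smooth d M)) (n : ℕ) :
    ((coeff n (starMul C u v) : Smooth d M) : M → ℂ) x =
      ((coeff n (starMul C u' v') : Smooth d M) : M → ℂ) x := by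
  rw [coeff_starMul, coeff_starMul]
  simp only [smooth_sum_apply]
  exact Finset.sum_congr rfl fun p _ => Finset.sum_congr rfl fun q _ => (hC _).congr (hu _) (hv _)

theorem starMul_X_left (u v : PowerSeries (Smooth d M)) :
    starMul C (X * u) v = X * starMul C u v := by
  ext1 n
  cases n with
  | zero => simp [coeff_starMul]
  | succ n =>
    rw [coeff_succ_X_mul, coeff_starMul, coeff_starMul, Nat.sum_antidiagonal_succ']
    simp [Nat.sum_antidiagonal_succ, coeff_succ_X_mul]

theorem starMul_X_right (u v : PowerSeries (Smooth d M)) :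
    starMul C u (X * v) = X * starMul C u v := by
  ext1 n
  cases n with
  | zero => simp [coeff_starMul]
  | succ n =>
    rw [coeff_succ_X_mul, coeff_starMul, coeff_starMul, Nat.sum_antidiagonal_succ']
    simp [Nat.sum_antidiagonal_succ', coeff_succ_X_mul]

theorem starMul_X_pow_left (t : ℕ) (u v : PowerSeries (Smooth d M)) :
    starMul C (X ^ t * u) v = X ^ t * starMul C u v := by
  induction t with
  | zero => simp
  | succ t ih => rw [pow_succ', mul_assoc, starMul_X_left, ih, mul_assoc]

theorem starMul_X_pow_right (t : ℕ) (u v : PowerSeries (Smooth d M)) :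
    starMul C u (X ^ t * v) = X ^ t * starMul C u v := by
  induction t with
  | zero => simp
  | succ t ih => rw [pow_succ', mul_assoc, starMul_X_right, ih, mul_assoc]

theorem starMul_sum_left {ι : Type*} (s : Finset ι) (u : ι → PowerSeries (Smooth d M))
    (v : PowerSeries (Smooth d M)) :
    starMul C (∑ i ∈ s, u i) v = ∑ i ∈ s, starMul C (u i) v := by
  ext1 n
  simp only [coeff_starMul, map_sum, LinearMap.sum_apply]
  conv_rhs => rw [Finset.sum_comm]
  refine Finset.sum_congr rfl fun p _ => ?_
  rw [Finset.sum_comm]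

theorem starMul_sum_right {ι : Type*} (s : Finset ι) (u : ι → PowerSeries (Smooth d M))
    (v : PowerSeries (Smooth d M)) :
    starMul C v (∑ i ∈ s, u i) = ∑ i ∈ s, starMul C v (u i) := by
  ext1 n
  simp only [coeff_starMul, map_sum]
  conv_rhs => rw [Finset.sum_comm]
  refine Finset.sum_congr rfl fun p _ => ?_
  rw [Finset.sum_comm]

theorem starMul_zero_left (v : PowerSeries (Smooth d M)) : starMul C 0 v = 0 := by
  ext1 n
  simp [coeff_starMul]

theorem starMul_zero_right (v : PowerSeries (Smooth d M)) : starMul C v 0 = 0 := by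
  ext1 n
  simp [coeff_starMul]

theorem coeff_starMul_C_right (u : PowerSeries (Smooth d M)) (b : Smooth d M) (n : ℕ) :
    coeff n (starMul C u (PowerSeries.C b)) =
      ∑ p ∈ antidiagonal n, C p.1 (coeff p.2 u) b := by
  rw [coeff_starMul]
  refine Finset.sum_congr rfl fun p _ => ?_
  rw [Finset.sum_eq_single (p.2, 0)]
  · simp
  · rintro ⟨q₁, q₂⟩ hq hne
    have : q₂ ≠ 0 := by
      rintro rfl
      rw [HasAntidiagonal.mem_antidiagonal] at hq
      exact hne (by rw [← hq]; simp)
    rw [coeff_C, if_neg this, map_zero]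
  · intro h
    exact absurd (by simp) h

theorem coeff_starMul_C_left (u : PowerSeries (Smooth d M)) (b : Smooth d M) (n : ℕ) :
    coeff n (starMul C (PowerSeries.C b) u) =
      ∑ p ∈ antidiagonal n, C p.1 b (coeff p.2 u) := by
  rw [coeff_starMul]
  refine Finset.sum_congr rfl fun p _ => ?_
  rw [Finset.sum_eq_single (0, p.2)]
  · simp
  · rintro ⟨q₁, q₂⟩ hq hne
    have : q₁ ≠ 0 := by
      rintro rfl
      rw [HasAntidiagonal.mem_antidiagonal] at hq
      exact hne (by rw [← hq]; simp)
    rw [coeff_C, if_neg this, map_zero, LinearMap.zero_apply]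
  · intro h
    exact absurd (by simp) h

end StarAlgebra

/-! ### Traces and commutators with functions of noncompact support -/

section Commutator

open PowerSeries Finset

variable {d : ℕ} {M : Type*} [TopologicalSpace M] [ChartedSpace (E d) M] {Ω : TwoForm d M}

/-- The star commutator of an element of `N_c[[ν]]` with a function which need not have compact
support. -/
noncomputable def commutator (S : StarProduct Ω) (a : CompactSeries d M) (b : Smooth d M) :
    CompactSeries d M :=
  ⟨starMul S.C a (PowerSeries.C b) - starMul S.C (PowerSeries.C b) a, by
    refine Submodule.sub_mem _ (fun n => ?_) fun n => ?_
    · rw [coeff_starMul_C_right]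
      exact hasCompactSupport_sum _ _ fun p _ => (S.bidifferential p.1).hasCompactSupport (a.2 _)
    · rw [coeff_starMul_C_left]
      exact hasCompactSupport_sum _ _ fun p _ =>
        (S.bidifferential p.1).hasCompactSupport_right (a.2 _)⟩

/-- A diagonal choice: a property holding eventually at each level holds up to levels tending to
infinity. -/
theorem exists_tendsto_levels {Q : ℕ → ℕ → Prop} (h0 : ∀ k, Q k 0)
    (h : ∀ m, ∀ᶠ k in Filter.atTop, Q k m) :
    ∃ t : ℕ → ℕ, (∀ k, Q k (t k)) ∧ ∀ m, ∃ K, ∀ k ≥ K, m < t k := by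
  classical
  refine ⟨fun k => Nat.findGreatest (Q k) k, fun k => Nat.findGreatest_spec (Nat.zero_le k) (h0 k),
    fun m => ?_⟩
  obtain ⟨K, hK⟩ := Filter.eventually_atTop.mp (h (m + 1))
  refine ⟨max K (m + 1), fun k hk => ?_⟩
  exact Nat.le_findGreatest (le_trans (le_max_right _ _) hk) (hK k (le_trans (le_max_left _ _) hk))

variable [IsManifold (𝓡 d) ∞ M] [T2Space M] [SigmaCompactSpace M]

/-- A real smooth function as an element of `C^∞(M, ℂ)`. -/
def toSmooth (b : M → ℝ) (hb : ContMDiff (𝓡 d) 𝓘(ℝ, ℝ) ∞ b) : Smooth d M :=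
  ⟨toComplex b, Complex.ofRealCLM.contDiff.contMDiff.comp hb⟩

/-- A trace vanishes on commutators with functions which need not have compact support. As the
supports of the coefficients of `a` may exhaust `M`, such a commutator is not obviously one of
elements of `N_c[[ν]]`; it becomes a sum of four of them by cutting `a` into annuli and shifting
half of the power of `ν` available on each annulus to the other factor. -/
theorem IsTrace.commutator_eq_zero {S : StarProduct Ω}
    {τ : CompactSeries d M →ₗ[PowerSeries ℂ] LaurentSeries ℂ} (hτ : IsTrace S τ)
    (a : CompactSeries d M) (b : Smooth d M) : τ (commutator S a b) = 0 := by
  obtain ⟨A⟩ := Annuli.nonempty d M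
  let X' : ℕ → Smooth d M := fun k => toSmooth (A.χ k) (A.smooth_χ k)
  let Θ : ℕ → Smooth d M := fun k => toSmooth (A.θ k) (A.smooth_θ k)
  let a' : ℕ → Smooth d M := fun p => coeff p (a : PowerSeries (Smooth d M))
  have hX : ∀ k z, (X' k : M → ℂ) z = (A.χ k z : ℂ) := fun _ _ => rfl
  have hΘ : ∀ k z, (Θ k : M → ℂ) z = (A.θ k z : ℂ) := fun _ _ => rfl
  have hχθ : ∀ k z, z ∉ tsupport (A.θ k) → A.χ k z = 0 := by
    intro k z hz
    by_contra h
    refine hz (subset_tsupport _ ?_)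
    rw [Function.mem_support, (A.θ_eq_one k z (subset_tsupport _ h)).self_of_nhds]
    simp
  obtain ⟨t, htQ, htT⟩ := exists_tendsto_levels (Q := fun k m => ∀ p < 2 * m, X' k * a' p = 0)
    (fun k p hp => absurd hp (by omega)) (fun m => by
      have hp : ∀ p, ∀ᶠ k in Filter.atTop, X' k * a' p = 0 := by
        intro p
        obtain ⟨m, hm⟩ := A.eventually_disjoint _ (a.2 p)
        filter_upwards [Filter.eventually_ge_atTop m] with k hk
        apply Subtype.ext
        ext z
        change (A.χ k z : ℂ) * (a' p : M → ℂ) z = 0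
        by_cases hz : z ∈ tsupport (A.θ k)
        · have : z ∉ tsupport (a' p : M → ℂ) := Set.disjoint_left.mp (hm k hk) hz
          rw [image_eq_zero_of_notMem_tsupport this, mul_zero]
        · rw [hχθ k z hz]; simp
      have := (Finset.range (2 * m)).eventually_all.mpr fun p _ => hp p
      filter_upwards [this] with k hk p hp
      exact hk p (Finset.mem_range.mpr hp))
  choose T hT using htT
  -- the pieces of `a` of a given colour, and the two factors into which they are shifted
  let ac : ℕ → PowerSeries (Smooth d M) := fun c => PowerSeries.mk fun p =>
    ∑ k ∈ range (T p), if k % 4 = c then X' k * a' p else 0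
  let a1 : ℕ → PowerSeries (Smooth d M) := fun c => PowerSeries.mk fun p =>
    ∑ k ∈ range (T p), if k % 4 = c then X' k * a' (p + t k) else 0
  let b1 : ℕ → PowerSeries (Smooth d M) := fun c => PowerSeries.mk fun q =>
    ∑ k ∈ range (T q), if k % 4 = c ∧ t k = q then Θ k * b else 0
  have hac : ∀ c, ac c ∈ CompactSeries d M := fun c p => by
    rw [coeff_mk]
    refine hasCompactSupport_sum _ _ fun k _ => ?_
    split_ifs
    · exact (a.2 p).mul_left
    · exact HasCompactSupport.zero
  have ha1 : ∀ c, a1 c ∈ CompactSeries d M := fun c p => by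
    rw [coeff_mk]
    refine hasCompactSupport_sum _ _ fun k _ => ?_
    split_ifs
    · exact (a.2 (p + t k)).mul_left
    · exact HasCompactSupport.zero
  have hΘc : ∀ k, HasCompactSupport (Θ k : M → ℂ) := fun k =>
    (A.compact_θ k).comp_left (g := fun r : ℝ => (r : ℂ)) (by simp)
  have hb1 : ∀ c, b1 c ∈ CompactSeries d M := fun c p => by
    rw [coeff_mk]
    refine hasCompactSupport_sum _ _ fun k _ => ?_
    split_ifs
    · exact (hΘc k).mul_right
    · exact HasCompactSupport.zero
  -- near any point, either the pieces vanish or a single annulus of the given colour matters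
  have hgerm : ∀ c x, (∀ p, ((coeff p (ac c) : Smooth d M) : M → ℂ) =ᶠ[𝓝 x] (0 : Smooth d M)) ∧
      (∀ p, ((coeff p (a1 c) : Smooth d M) : M → ℂ) =ᶠ[𝓝 x] (0 : Smooth d M)) ∨
      ∃ (s : ℕ) (α : PowerSeries (Smooth d M)),
        (∀ p, ((coeff p (ac c) : Smooth d M) : M → ℂ) =ᶠ[𝓝 x] (coeff p (X ^ s * α) : Smooth d M)) ∧
        (∀ p, ((coeff p (a1 c) : Smooth d M) : M → ℂ) =ᶠ[𝓝 x] (coeff p α : Smooth d M)) ∧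
        ∀ p, ((coeff p (b1 c) : Smooth d M) : M → ℂ) =ᶠ[𝓝 x]
          (coeff p (X ^ s * PowerSeries.C b) : Smooth d M) := by
    intro c x
    by_cases hk : ∃ k, k % 4 = c ∧ x ∈ tsupport (A.χ k)
    · obtain ⟨k, hkc, hxk⟩ := hk
      refine Or.inr ⟨t k, PowerSeries.mk fun p => X' k * a' (p + t k), fun p => ?_, fun p => ?_,
        fun p => ?_⟩
      all_goals
        filter_upwards [A.θ_eq_one k x hxk] with z hz
        have hzk : z ∈ tsupport (A.θ k) := subset_tsupport _ (by
          rw [Function.mem_support, hz]; simp)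
        have hzl : ∀ l, l ≠ k → l % 4 = c → z ∉ tsupport (A.θ l) := by
          intro l hl hlc
          rcases lt_or_gt_of_ne hl with h | h
          · exact Set.disjoint_right.mp (A.disjoint_θ l k (by omega)) hzk
          · exact Set.disjoint_left.mp (A.disjoint_θ k l (by omega)) hzk
        rw [coeff_mk, smooth_sum_apply, Finset.sum_eq_single k]
      · rw [if_pos hkc, coeff_X_pow_mul']
        split_ifs with hp
        · rw [coeff_mk, Nat.sub_add_cancel hp]
        · rw [htQ k p (by omega)]
      · intro l _ hl
        split_ifs with hlc
        · change (A.χ l z : ℂ) * _ = 0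
          rw [hχθ l z (hzl l hl hlc)]; simp
        · rfl
      · intro hkT
        rw [if_pos hkc, htQ k p (by
          have := hT p k (by simpa using hkT)
          omega)]
        rfl
      · rw [if_pos hkc, coeff_mk]
      · intro l _ hl
        split_ifs with hlc
        · change (A.χ l z : ℂ) * _ = 0
          rw [hχθ l z (hzl l hl hlc)]; simp
        · rfl
      · intro hkT
        rw [if_pos hkc, htQ k (p + t k) (by
          have := hT p k (by simpa using hkT)
          omega)]
        rfl
      · rw [coeff_X_pow_mul']
        by_cases hp : t k = p
        · rw [if_pos ⟨hkc, hp⟩, if_pos hp.le, hp, Nat.sub_self, coeff_zero_C]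
          change (A.θ k z : ℂ) * _ = _
          rw [hz]; simp
        · rw [if_neg (fun h => hp h.2)]
          split_ifs with hp'
          · rw [coeff_C, if_neg (by omega)]
          · rfl
      · intro l _ hl
        split_ifs with hlc
        · change (A.θ l z : ℂ) * _ = 0
          rw [image_eq_zero_of_notMem_tsupport (hzl l hl hlc.1)]; simp
        · rfl
      · intro hkT
        rw [if_neg]
        · rfl
        · rintro ⟨-, hp⟩
          have := hT p k (by simpa using hkT)
          omega
    · left
      push Not at hk
      constructor
      all_goals
        intro p
        have : ∀ᶠ z in 𝓝 x, ∀ k ∈ range (T p), k % 4 = c → A.χ k z = 0 := by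
          refine (Finset.eventually_all _).mpr fun k _ => ?_
          by_cases hkc : k % 4 = c
          · filter_upwards [notMem_tsupport_iff_eventuallyEq.mp (hk k hkc)] with z hz _
            exact hz
          · exact Filter.Eventually.of_forall fun z h => absurd h hkc
        filter_upwards [this] with z hz
        rw [coeff_mk, smooth_sum_apply]
        refine Finset.sum_eq_zero fun k hkT => ?_
        split_ifs with hkc
        · change (A.χ k z : ℂ) * _ = 0
          rw [hz k hkT hkc]; simp
        · rfl
  have hl : ∀ c, starMul S.C (ac c) (PowerSeries.C b) = starMul S.C (a1 c) (b1 c) := by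
    intro c
    ext1 n
    apply Subtype.ext
    ext x
    rcases hgerm c x with ⟨h1, h2⟩ | ⟨s, α, h1, h2, h3⟩
    · have e1 := starMul_congr S.C S.bidifferential (u := ac c) (u' := 0) (v := PowerSeries.C b)
        (by simpa using h1) (fun i => .rfl) n
      have e2 := starMul_congr S.C S.bidifferential (u := a1 c) (u' := 0) (v := b1 c)
        (by simpa using h2) (fun i => .rfl) n
      rw [starMul_zero_left] at e1 e2
      rw [e1, e2]
    · rw [starMul_congr S.C S.bidifferential h1 fun i => .rfl,
        starMul_congr S.C S.bidifferential h2 h3, starMul_X_pow_left, starMul_X_pow_right]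
  have hr : ∀ c, starMul S.C (PowerSeries.C b) (ac c) = starMul S.C (b1 c) (a1 c) := by
    intro c
    ext1 n
    apply Subtype.ext
    ext x
    rcases hgerm c x with ⟨h1, h2⟩ | ⟨s, α, h1, h2, h3⟩
    · have e1 := starMul_congr S.C S.bidifferential (v := ac c) (v' := 0) (u := PowerSeries.C b)
        (fun i => .rfl) (by simpa using h1) n
      have e2 := starMul_congr S.C S.bidifferential (v := a1 c) (v' := 0) (u := b1 c)
        (fun i => .rfl) (by simpa using h2) n
      rw [starMul_zero_right] at e1 e2
      rw [e1, e2]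
    · rw [starMul_congr S.C S.bidifferential (fun i => .rfl) h1,
        starMul_congr S.C S.bidifferential h3 h2, starMul_X_pow_left, starMul_X_pow_right]
  have hsum : (a : PowerSeries (Smooth d M)) = ∑ c ∈ range 4, ac c := by
    ext1 p
    rw [map_sum]
    simp only [ac, coeff_mk]
    rw [Finset.sum_comm]
    have h1 : ∀ k, (∑ c ∈ range 4, if k % 4 = c then X' k * a' p else 0) = X' k * a' p := by
      intro k
      rw [Finset.sum_ite_eq, if_pos (Finset.mem_range.mpr (Nat.mod_lt _ (by norm_num)))]
    simp only [h1]
    apply Subtype.ext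
    ext x
    obtain ⟨m, hm⟩ := A.sum_χ x
    have h2 := hm (max m (T p)) (le_max_left _ _)
    have h3 : ∑ k ∈ range (T p), X' k * a' p = ∑ k ∈ range (max m (T p)), X' k * a' p := by
      refine Finset.sum_subset (Finset.range_mono (le_max_right _ _)) fun k _ hk => ?_
      exact htQ k p (by
        have := hT p k (by simpa using hk)
        omega)
    rw [h3, smooth_sum_apply]
    change (a' p : M → ℂ) x = ∑ k ∈ range (max m (T p)), (A.χ k x : ℂ) * (a' p : M → ℂ) x
    rw [← Finset.sum_mul, ← Complex.ofReal_sum, h2]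
    simp
  have hcomm : commutator S a b = ∑ c ∈ range 4,
      (S.mul ⟨a1 c, ha1 c⟩ ⟨b1 c, hb1 c⟩ - S.mul ⟨b1 c, hb1 c⟩ ⟨a1 c, ha1 c⟩) := by
    apply Subtype.ext
    rw [AddSubmonoidClass.coe_finsetSum]
    change starMul S.C a (PowerSeries.C b) - starMul S.C (PowerSeries.C b) a =
      ∑ c ∈ range 4, (starMul S.C (a1 c) (b1 c) - starMul S.C (b1 c) (a1 c))
    rw [hsum, starMul_sum_left, starMul_sum_right, ← Finset.sum_sub_distrib]
    exact Finset.sum_congr rfl fun c _ => by rw [hl, hr]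
  rw [hcomm, map_sum]
  refine Finset.sum_eq_zero fun c _ => ?_
  have h1 := τ.map_sub (S.mul ⟨a1 c, ha1 c⟩ ⟨b1 c, hb1 c⟩) (S.mul ⟨b1 c, hb1 c⟩ ⟨a1 c, ha1 c⟩)
  rw [hτ ⟨a1 c, ha1 c⟩ ⟨b1 c, hb1 c⟩, sub_self] at h1
  exact h1

end Commutator

/-! ### Reduction modulo commutators -/

section Recursion

open PowerSeries Finset

/-- Construction of a sequence by course-of-values recursion from a solvable relation. -/
theorem exists_seq_of_forall_exists {Y : Type*} [Inhabited Y] (P : ℕ → (ℕ → Y) → Y → Prop)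
    (hex : ∀ n s, ∃ y, P n s y)
    (hcongr : ∀ n s s' y, (∀ p < n, s p = s' p) → P n s y → P n s' y) :
    ∃ s : ℕ → Y, ∀ n, P n s (s n) := by
  classical
  let ext : ∀ n, (∀ m, m < n → Y) → ℕ → Y := fun n ih m => if h : m < n then ih m h else default
  let F : ∀ n, (∀ m, m < n → Y) → Y := fun n ih => (hex n (ext n ih)).choose
  let s : ℕ → Y := fun n => Nat.lt_wfRel.wf.fix F n
  refine ⟨s, fun n => ?_⟩
  have hs : s n = F n fun m _ => s m := Nat.lt_wfRel.wf.fix_eq F n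
  have h1 := (hex n (ext n fun m _ => s m)).choose_spec
  rw [hs]
  refine hcongr n _ _ _ (fun p hp => ?_) h1
  simp only [ext, dif_pos hp]

variable {d : ℕ} {M : Type*} [TopologicalSpace M] [ChartedSpace (E d) M] {Ω : TwoForm d M}

theorem coeff_commutator (S : StarProduct Ω) (a : CompactSeries d M) (b : Smooth d M) (n : ℕ) :
    coeff n (commutator S a b : PowerSeries (Smooth d M)) = ∑ p ∈ range (n + 1),
      (S.C (n - p) (coeff p (a : PowerSeries (Smooth d M))) b -
        S.C (n - p) b (coeff p (a : PowerSeries (Smooth d M)))) := by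
  change coeff n (starMul S.C a (PowerSeries.C b) - starMul S.C (PowerSeries.C b) a) = _
  rw [map_sub, coeff_starMul_C_right, coeff_starMul_C_left, ← Finset.sum_sub_distrib,
    ← Nat.sum_antidiagonal_swap]
  rw [Nat.sum_antidiagonal_eq_sum_range_succ_mk]
  rfl

variable [IsManifold (𝓡 d) ∞ M] [T2Space M] [SigmaCompactSpace M]

/-- The multiple `c` is the same for all traces, so every trace is determined by its value
on `ρ`. -/
theorem IsTrace.eq_smul {S : StarProduct Ω}
    {τ : CompactSeries d M →ₗ[PowerSeries ℂ] LaurentSeries ℂ} (hτ : IsTrace S τ)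
    {ι : Type*} [Fintype ι] {u ρ : CompactSeries d M} {c : PowerSeries ℂ}
    {a : ι → CompactSeries d M} {b : ι → Smooth d M}
    (h : (PowerSeries.X : PowerSeries ℂ) • (u - c • ρ) = ∑ j, commutator S (a j) (b j)) :
    τ u = algebraMap (PowerSeries ℂ) (LaurentSeries ℂ) c * τ ρ := by
  have h1 := congrArg τ h
  rw [map_sum, Finset.sum_eq_zero fun j _ => hτ.commutator_eq_zero (a j) (b j), map_smul,
    Algebra.smul_def, mul_eq_zero, map_eq_zero_iff _ (FaithfulSMul.algebraMap_injective _ _)] at h1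
  have h2 := τ.map_sub u (c • ρ)
  rw [h1.resolve_left PowerSeries.X_ne_zero, eq_comm, sub_eq_zero] at h2
  rw [h2, map_smul, Algebra.smul_def]

variable [SecondCountableTopology M] [ConnectedSpace M]

/-- Modulo star commutators and up to a factor `ν`, `N_c[[ν]]` is spanned over `ℂ[[ν]]` by a single
function. The elements `a j` and the coefficients of `c` are constructed order by order. -/
theorem exists_eq_smul_add_commutator (hΩ : IsSymplectic Ω) (S : StarProduct Ω) :
    ∃ ρ : CompactSeries d M, ∀ u : CompactSeries d M, ∃ (c : PowerSeries ℂ)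
      (a : Fin 4 × Fin (2 * d) → CompactSeries d M) (b : Fin 4 × Fin (2 * d) → Smooth d M),
      (PowerSeries.X : PowerSeries ℂ) • (u - c • ρ) = ∑ j, commutator S (a j) (b j) := by
  obtain ⟨b, hb⟩ := exists_spansCotangent (d := d) (M := M)
  obtain ⟨ρ, hρ, hf⟩ := hb.exists_global hΩ
  obtain ⟨κ, hκ, hC1⟩ := S.C_one
  let b' : Fin 4 × Fin (2 * d) → Smooth d M := fun j => toSmooth (b j) (hb.smooth j)
  let D : ℕ → Smooth d M → Smooth d M → Smooth d M := fun r u v => S.C r u v - S.C r v u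
  have hDc : ∀ r (u v : Smooth d M), HasCompactSupport (u : M → ℂ) →
      HasCompactSupport (D r u v : M → ℂ) :=
    fun r u v hu => ((S.bidifferential r).hasCompactSupport hu).sub
      ((S.bidifferential r).hasCompactSupport_right hu)
  have hρm : PowerSeries.C ρ ∈ CompactSeries d M := fun k => by
    rw [coeff_C]
    split_ifs
    · exact hρ
    · exact HasCompactSupport.zero
  refine ⟨⟨PowerSeries.C ρ, hρm⟩, fun u => ?_⟩
  let u' : ℕ → Smooth d M := fun n => coeff n (u : PowerSeries (Smooth d M))
  -- the contribution to order `n + 1` of the coefficients of order less than `n`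
  let low : ℕ → (ℕ → ℂ × (Fin 4 × Fin (2 * d) → {a : Smooth d M // HasCompactSupport (a : M → ℂ)})) →
      Smooth d M := fun n s => ∑ j, ∑ p ∈ range n, D (n + 1 - p) ((s p).2 j).1 (b' j)
  have : Inhabited {a : Smooth d M // HasCompactSupport (a : M → ℂ)} :=
    ⟨⟨0, HasCompactSupport.zero⟩⟩
  obtain ⟨s, hs⟩ := exists_seq_of_forall_exists
    (fun n s (y : ℂ × (Fin 4 × Fin (2 * d) → {a : Smooth d M // HasCompactSupport (a : M → ℂ)})) =>
      ∀ x, (u' n : M → ℂ) x - (low n s : M → ℂ) x =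
        y.1 * (ρ : M → ℂ) x + ∑ j, κ * poisson Ω (y.2 j).1 (b' j) x)
    (fun n s => by
      obtain ⟨c, a, ha, h⟩ := hf (u' n - low n s) ((u.2 n).sub (hasCompactSupport_sum _ _
        fun j _ => hasCompactSupport_sum _ _ fun p _ => hDc _ _ _ ((s p).2 j).2))
      refine ⟨(c, fun j => ⟨κ⁻¹ • a j, (ha j).smul_left (f := fun _ => κ⁻¹)⟩), fun x => ?_⟩
      have h1 := h x
      simp only [poisson_smul, ← mul_assoc, mul_inv_cancel₀ hκ, one_mul]
      exact h1)
    (fun n s s' y hss h x => by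
      have : low n s' = low n s := by
        refine Finset.sum_congr rfl fun j _ => Finset.sum_congr rfl fun p hp => ?_
        rw [hss p (Finset.mem_range.mp hp)]
      rw [this]
      exact h x)
  let a : Fin 4 × Fin (2 * d) → CompactSeries d M := fun j =>
    ⟨PowerSeries.mk fun n => ((s n).2 j).1, fun n => by rw [coeff_mk]; exact ((s n).2 j).2⟩
  have hac : ∀ j n, coeff n (a j : PowerSeries (Smooth d M)) = ((s n).2 j).1 := fun j n =>
    coeff_mk n fun n => ((s n).2 j).1
  refine ⟨PowerSeries.mk fun n => (s n).1, a, b', ?_⟩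
  have hD0 : ∀ v w, D 0 v w = 0 := fun v w => by
    simp only [D, S.C_zero, mul_comm v w, sub_self]
  apply Subtype.ext
  rw [AddSubmonoidClass.coe_finsetSum]
  change (PowerSeries.X : PowerSeries ℂ) • ((u : PowerSeries (Smooth d M)) -
    (PowerSeries.mk fun n => (s n).1 : PowerSeries ℂ) • PowerSeries.C ρ) = _
  simp only [Algebra.smul_def, PowerSeries.algebraMap_apply'', PowerSeries.map_X]
  ext1 n
  rw [map_sum]
  simp only [coeff_commutator, hac]
  cases n with
  | zero =>
    simp only [coeff_zero_X_mul, zero_add, Finset.sum_range_one, Nat.sub_self]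
    exact (Finset.sum_eq_zero fun j _ => hD0 _ _).symm
  | succ n =>
    rw [coeff_succ_X_mul, map_sub, coeff_mul_C, coeff_map, coeff_mk]
    have h1 : ∀ j, ∑ p ∈ range (n + 1 + 1), (S.C (n + 1 - p) ((s p).2 j).1 (b' j) -
        S.C (n + 1 - p) (b' j) ((s p).2 j).1) =
        (∑ p ∈ range n, D (n + 1 - p) ((s p).2 j).1 (b' j)) + D 1 ((s n).2 j).1 (b' j) := by
      intro j
      rw [Finset.sum_range_succ, Finset.sum_range_succ]
      have h2 : n + 1 - n = 1 := by omega
      have h3 := hD0 ((s (n + 1)).2 j).1 (b' j)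
      rw [h2, Nat.sub_self]
      simp only [D] at h3 ⊢
      rw [h3, add_zero]
    simp only [h1, Finset.sum_add_distrib]
    apply Subtype.ext
    ext x
    have h4 := hs n x
    change (u' n : M → ℂ) x - (s n).1 * (ρ : M → ℂ) x =
      (low n s : M → ℂ) x + ((∑ j, D 1 ((s n).2 j).1 (b' j) : Smooth d M) : M → ℂ) x
    rw [smooth_sum_apply univ fun j => D 1 ((s n).2 j).1 (b' j)]
    have h5 : ∀ j, (D 1 ((s n).2 j).1 (b' j) : M → ℂ) x =
        κ * poisson Ω ((s n).2 j).1 (b' j) x := fun j => hC1 _ _ x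
    rw [Finset.sum_congr rfl fun j _ => h5 j]
    linear_combination h4

end Recursion

end StarTrace
theorem mainTheorem2 (n : ℕ) (M : Type*) [TopologicalSpace M] [T2Space M]
    [SecondCountableTopology M] [ConnectedSpace M]
    [ChartedSpace (EuclideanSpace ℝ (Fin (2 * n))) M] [IsManifold (𝓡 (2 * n)) ∞ M]
    (Ω : StarTrace.TwoForm (2 * n) M) (hΩ : StarTrace.IsSymplectic Ω)
    (S : StarTrace.StarProduct Ω)
    (τ τ' : StarTrace.CompactSeries (2 * n) M →ₗ[PowerSeries ℂ] LaurentSeries ℂ)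
    (hτ : StarTrace.IsTrace S τ) (hτ' : StarTrace.IsTrace S τ') (hτ0 : τ ≠ 0) :
    ∃ c : LaurentSeries ℂ, ∀ u : StarTrace.CompactSeries (2 * n) M, τ' u = c * τ u := by
  have : LocallyCompactSpace M := ChartedSpace.locallyCompactSpace (StarTrace.E (2 * n)) M
  obtain ⟨ρ, hρ⟩ := StarTrace.exists_eq_smul_add_commutator hΩ S
  have hρ0 : τ ρ ≠ 0 := by
    intro h0
    refine hτ0 (LinearMap.ext fun u => ?_)
    obtain ⟨c, a, b, h⟩ := hρ u
    rw [hτ.eq_smul h, h0, mul_zero]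
    rfl
  refine ⟨τ' ρ / τ ρ, fun u => ?_⟩
  obtain ⟨c, a, b, h⟩ := hρ u
  rw [hτ.eq_smul h, hτ'.eq_smul h, mul_left_comm, div_mul_cancel₀ _ hρ0]
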